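/- Let $n\in\{2,3\}$ and let $\Omega\subset\mathbb R^n$ be a bounded domain (non-empty, open, connected) with Lipschitz continuous boundary $S$. Let $\Gamma_1,\dots,\Gamma_k$ (control electrodes) and $\Gamma_{10},\dots,\Gamma_{k0}$ (null electrodes) be open subsets of $S$, not all empty, such that the $\Gamma_i$ are pairwise disjoint and $\Gamma_i\cap\Gamma_{j0}=\emptyset$ for all $i,j$. Values on parts of $S$ are understood in the sense of traces of functions of $H^1(\Omega)$, almost everywhere for the surface measure. Let $\epsilon\in L_\infty(\Omega)$ satisfy $e_1\le\epsilon\le e_2$ a.e. in $\Omega$ with positive constants $e_1,e_2$. Let $T>0$ and, for $t\in[0,T]$ and $i=1,\dots,k$, let $$U_i(t)\in H^{1/2}_{00}(\Gamma_i)=\{\psi \mid \psi=v|_{\Gamma_i},\ v\in H^1(\Omega),\ v|_{S\setminus\overline{\Gamma_i}}=0\}.$$ Put $\tilde V=\{v\in H^1(\Omega)\mid v=0 \text{ on } \bigcup_{i=1}^k(\Gamma_i\cup\Gamma_{i0})\}$ and $$a(v,h)=\int_\Omega \epsilon\,\nabla v\cdot\nabla h\,dx .$$ A generalized solution, at time $t$,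 of the mixed problem $$\operatorname{div}(\epsilon\nabla\theta)=0 \text{ in }\Omega,\quad \theta=U_i(t)\text{ on }\Gamma_i,\quad \theta=0\text{ on }\Gamma_{i0}\ (i=1,\dots,k),\quad \nu\cdot\epsilon\nabla\theta=0\text{ on } S\setminus\overline{\textstyle\bigcup_{i}(\Gamma_i\cup\Gamma_{i0})}$$ is a function $\theta\in H^1(\Omega)$ with $\theta|_{\Gamma_i}=U_i(t)$ and $\theta|_{\Gamma_{i0}}=0$ for all $i$, such that $a(\theta,h)=0$ for all $h\in\tilde V$. Then for every $t\in[0,T]$ there exist functions $\check\theta\in H^1(\Omega)$ with $\check\theta|_{\Gamma_i}=U_i(t)$ and $\check\theta|_{\Gamma_{i0}}=0$ for $i=1,\dots,k$, and there exists a unique generalized solution $\theta$ of the mixed problem. Moreover, for every such $\check\theta$ the problem: find $u\in\tilde V$ with $$a(u,h)=-a(\check\theta,h)\qquad\text{for all } h\in\tilde V$$ has a unique solution $u$, and $\theta=\check\theta+u$. -/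

import Mathlib

open MeasureTheory Filter Topology Set
open scoped ENNReal NNReal ContDiff

noncomputable section

namespace Electrostatics

/-- Euclidean space `ℝⁿ`. -/
abbrev E (n : ℕ) : Type := EuclideanSpace ℝ (Fin n)

variable {n : ℕ}

/-- A bounded domain (non-empty connected open set) with Lipschitz continuous boundary: near each
boundary point, in suitable orthogonal coordinates `(x', xₙ)`, the domain is the set of the points
lying above the graph of a Lipschitz function of `x'`. -/
structure IsBoundedLipschitzDomain (Ω : Set (E n)) : Prop where
  isOpen : IsOpen Ω
  isConnected : IsConnected Ω
  isBounded : Bornology.IsBounded Ω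
  locally_graph : ∀ x₀ ∈ frontier Ω,
    ∃ (Φ : E n ≃ₗᵢ[ℝ] WithLp 2 (E (n - 1) × ℝ)) (γ : E (n - 1) → ℝ) (K : ℝ≥0) (r : ℝ),
      LipschitzWith K γ ∧ 0 < r ∧
        ∀ x ∈ Metric.ball x₀ r, x ∈ Ω ↔ γ (Φ x).fst < (Φ x).snd

/-- `Γ` is an open subset of the boundary `S = frontier Ω` (in the relative topology of `S`). -/
def IsOpenInBoundary (Ω Γ : Set (E n)) : Prop :=
  ∃ O : Set (E n), IsOpen O ∧ Γ = O ∩ frontier Ω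

/-- The `(n-1)`-dimensional surface measure on the boundary `S = frontier Ω`. -/
def surfaceMeasure (Ω : Set (E n)) : Measure (E n) :=
  (μHE[n - 1] : Measure (E n)).restrict (frontier Ω)

/-- `G` is the weak gradient of `u` in `Ω`. -/
def IsWeakGradient (Ω : Set (E n)) (u : E n → ℝ) (G : E n → E n) : Prop :=
  ∀ φ : E n → ℝ, ContDiff ℝ ∞ φ → HasCompactSupport φ → tsupport φ ⊆ Ω → ∀ i : Fin n,
    ∫ x in Ω, u x * fderiv ℝ φ x (EuclideanSpace.single i 1) = - ∫ x in Ω, G x i * φ x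

lemma integrable_mul_test {Ω : Set (E n)} {f g : E n → ℝ}
    (hf : MemLp f 2 (volume.restrict Ω)) (hg : Continuous g) (hs : HasCompactSupport g) :
    Integrable (fun x => f x * g x) (volume.restrict Ω) :=
  MemLp.integrable_mul (p := 2) (q := 2) hf (hg.memLp_of_hasCompactSupport hs)

lemma memLp_coord {Ω : Set (E n)} (G : Lp (E n) 2 (volume.restrict Ω)) (i : Fin n) :
    MemLp (fun x => G x i) 2 (volume.restrict Ω) :=
  (Lp.memLp G).continuousLinearMap_comp (EuclideanSpace.proj i : E n →L[ℝ] ℝ)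

lemma test_deriv {φ : E n → ℝ} (h1 : ContDiff ℝ ∞ φ) (h2 : HasCompactSupport φ) (w : E n) :
    Continuous (fun x => fderiv ℝ φ x w) ∧ HasCompactSupport (fun x => fderiv ℝ φ x w) :=
  ⟨(h1.continuous_fderiv (by simp)).clm_apply continuous_const, h2.fderiv_apply ℝ w⟩

/-- The Sobolev space `H¹(Ω)`: the pairs `(u, ∇u)` of a function `u ∈ L²(Ω)` and its weak gradient
`∇u ∈ L²(Ω)ⁿ`, with the norm `(‖u‖² + ‖∇u‖²)^{1/2}`. The second component is determined by the
first one. -/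
def H1 (Ω : Set (E n)) :
    Submodule ℝ (WithLp 2 (Lp ℝ 2 (volume.restrict Ω) × Lp (E n) 2 (volume.restrict Ω))) where
  carrier := {p | IsWeakGradient Ω p.fst p.snd}
  zero_mem' := by
    intro φ _ _ _ i
    have e1 : ∫ x in Ω, ((0 : Lp ℝ 2 (volume.restrict Ω)) : E n → ℝ) x *
        fderiv ℝ φ x (EuclideanSpace.single i 1) = 0 := by
      refine integral_eq_zero_of_ae ?_
      filter_upwards [Lp.coeFn_zero ℝ 2 (volume.restrict Ω)] with x hx
      rw [hx]
      simp
    have e2 : ∫ x in Ω, ((0 : Lp (E n) 2 (volume.restrict Ω)) : E n → E n) x i * φ x = 0 := by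
      refine integral_eq_zero_of_ae ?_
      filter_upwards [Lp.coeFn_zero (E n) 2 (volume.restrict Ω)] with x hx
      rw [hx]
      simp
    simp only [WithLp.zero_fst, WithLp.zero_snd]
    rw [e1, e2, neg_zero]
  add_mem' := by
    intro p q hp hq φ h1 h2 h3 i
    have hd := test_deriv h1 h2 (EuclideanSpace.single i 1)
    have e1 : ∫ x in Ω, (p.fst + q.fst : Lp ℝ 2 (volume.restrict Ω)) x *
        fderiv ℝ φ x (EuclideanSpace.single i 1) =
        ∫ x in Ω, (p.fst x * fderiv ℝ φ x (EuclideanSpace.single i 1) +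
          q.fst x * fderiv ℝ φ x (EuclideanSpace.single i 1)) := by
      refine integral_congr_ae ?_
      filter_upwards [Lp.coeFn_add p.fst q.fst] with x hx
      rw [hx, Pi.add_apply, add_mul]
    have e2 : ∫ x in Ω, (p.snd + q.snd : Lp (E n) 2 (volume.restrict Ω)) x i * φ x =
        ∫ x in Ω, (p.snd x i * φ x + q.snd x i * φ x) := by
      refine integral_congr_ae ?_
      filter_upwards [Lp.coeFn_add p.snd q.snd] with x hx
      rw [hx, Pi.add_apply, PiLp.add_apply, add_mul]
    simp only [WithLp.add_fst, WithLp.add_snd]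
    rw [e1, e2, integral_add (integrable_mul_test (Lp.memLp _) hd.1 hd.2)
        (integrable_mul_test (Lp.memLp _) hd.1 hd.2),
      integral_add (integrable_mul_test (memLp_coord _ i) h1.continuous h2)
        (integrable_mul_test (memLp_coord _ i) h1.continuous h2),
      hp φ h1 h2 h3 i, hq φ h1 h2 h3 i, neg_add]
  smul_mem' := by
    intro c p hp φ h1 h2 h3 i
    have e1 : ∫ x in Ω, (c • p.fst : Lp ℝ 2 (volume.restrict Ω)) x *
        fderiv ℝ φ x (EuclideanSpace.single i 1) =
        ∫ x in Ω, c * (p.fst x * fderiv ℝ φ x (EuclideanSpace.single i 1)) := by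
      refine integral_congr_ae ?_
      filter_upwards [Lp.coeFn_smul c p.fst] with x hx
      rw [hx, Pi.smul_apply, smul_eq_mul, mul_assoc]
    have e2 : ∫ x in Ω, (c • p.snd : Lp (E n) 2 (volume.restrict Ω)) x i * φ x =
        ∫ x in Ω, c * (p.snd x i * φ x) := by
      refine integral_congr_ae ?_
      filter_upwards [Lp.coeFn_smul c p.snd] with x hx
      rw [hx, Pi.smul_apply, PiLp.smul_apply, smul_eq_mul, mul_assoc]
    simp only [WithLp.smul_fst, WithLp.smul_snd]
    rw [e1, e2, integral_const_mul, integral_const_mul, hp φ h1 h2 h3 i, mul_neg]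

/-- The function underlying an element of `H¹(Ω)`. -/
def func {Ω : Set (E n)} (v : H1 Ω) : Lp ℝ 2 (volume.restrict Ω) :=
  (v : WithLp 2 (Lp ℝ 2 (volume.restrict Ω) × Lp (E n) 2 (volume.restrict Ω))).fst

/-- The weak gradient of an element of `H¹(Ω)`. -/
def grad {Ω : Set (E n)} (v : H1 Ω) : Lp (E n) 2 (volume.restrict Ω) :=
  (v : WithLp 2 (Lp ℝ 2 (volume.restrict Ω) × Lp (E n) 2 (volume.restrict Ω))).snd

/-- An element of `H¹(Ω)` is determined by its underlying function. -/
lemma H1_ext {Ω : Set (E n)} (hΩ : IsOpen Ω) {v w : H1 Ω} (h : func v = func w) : v = w := by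
  have hv : IsWeakGradient Ω (func v) (grad v) := v.2
  have hw : IsWeakGradient Ω (func w) (grad w) := w.2
  have hc : ∀ i : Fin n, ∀ᵐ x, x ∈ Ω → grad v x i - grad w x i = 0 := by
    intro i
    have hi : MemLp (fun x => grad v x i - grad w x i) 2 (volume.restrict Ω) :=
      (memLp_coord _ i).sub (memLp_coord _ i)
    refine hΩ.ae_eq_zero_of_integral_contDiff_smul_eq_zero
      (locallyIntegrableOn_of_locallyIntegrable_restrict (hi.locallyIntegrable (by norm_num))) ?_
    intro φ h1 h2 h3
    have key : ∫ x in Ω, φ x • (grad v x i - grad w x i) = 0 := by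
      have e : ∀ x, φ x • (grad v x i - grad w x i) = grad v x i * φ x - grad w x i * φ x := by
        intro x; simp only [smul_eq_mul]; ring
      simp only [e]
      rw [integral_sub (integrable_mul_test (memLp_coord _ i) h1.continuous h2)
        (integrable_mul_test (memLp_coord _ i) h1.continuous h2)]
      have a := hv φ h1 h2 h3 i
      have b := hw φ h1 h2 h3 i
      rw [h] at a
      linarith
    rwa [setIntegral_eq_integral_of_forall_compl_eq_zero] at key
    intro x hx
    rw [image_eq_zero_of_notMem_tsupport (fun hx' => hx (h3 hx')), zero_smul]
  have hg : grad v = grad w := by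
    refine Lp.ext ?_
    rw [Filter.EventuallyEq, ae_restrict_iff' hΩ.measurableSet]
    filter_upwards [ae_all_iff.2 hc] with x hx hxΩ
    ext i
    exact sub_eq_zero.1 (hx i hxΩ)
  apply Subtype.ext
  apply WithLp.ofLp_injective
  exact Prod.ext h hg

/-- `g ∈ L²(S)` is the trace of `v ∈ H¹(Ω)` on the boundary `S`. The trace operator is the
continuous extension of `φ ↦ φ|_S` from smooth functions to `H¹(Ω)`; this is its graph: some
smooth functions `φₘ` on `ℝⁿ` converge to `v` in `H¹(Ω)` while `φₘ|_S` converge to `g` in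
`L²(S)`. -/
def HasTrace {Ω : Set (E n)} (v : H1 Ω) (g : Lp ℝ 2 (surfaceMeasure Ω)) : Prop :=
  ∃ φ : ℕ → E n → ℝ,
    (∀ m, ContDiff ℝ ∞ (φ m) ∧ HasCompactSupport (φ m)) ∧
    Tendsto (fun m => eLpNorm (fun x => φ m x - func v x) 2 (volume.restrict Ω)) atTop (𝓝 0) ∧
    Tendsto (fun m => eLpNorm (fun x => gradient (φ m) x - grad v x) 2 (volume.restrict Ω))
      atTop (𝓝 0) ∧
    Tendsto (fun m => eLpNorm (fun x => φ m x - g x) 2 (surfaceMeasure Ω)) atTop (𝓝 0)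

/-- The space `H₀₀^{1/2}(Γ)` of the restrictions to `Γ` of the traces of those `v ∈ H¹(Ω)` whose
trace vanishes on `S \ closure Γ`. -/
def H00half (Ω Γ : Set (E n)) : Set (Lp ℝ 2 ((surfaceMeasure Ω).restrict Γ)) :=
  {ψ | ∃ (v : H1 Ω) (g : Lp ℝ 2 (surfaceMeasure Ω)), HasTrace v g ∧
    (g =ᵐ[(surfaceMeasure Ω).restrict Γ] ψ) ∧
    (g =ᵐ[(surfaceMeasure Ω).restrict (frontier Ω \ closure Γ)] 0)}

/-- The Dirichlet conditions on the electrodes for a function of `H¹(Ω)`: it equals `Uᵢ` on the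
control electrode `Γᵢ` and `0` on the null electrode `Γᵢ₀`, for all `i`. -/
def DirichletData {Ω : Set (E n)} {k : ℕ} (Γ Γ₀ : Fin k → Set (E n))
    (U : ∀ i, Lp ℝ 2 ((surfaceMeasure Ω).restrict (Γ i))) (v : H1 Ω) : Prop :=
  ∃ g : Lp ℝ 2 (surfaceMeasure Ω), HasTrace v g ∧
    (∀ i, g =ᵐ[(surfaceMeasure Ω).restrict (Γ i)] U i) ∧
    (∀ i, g =ᵐ[(surfaceMeasure Ω).restrict (Γ₀ i)] 0)

/-- The space `Ṽ` of the functions of `H¹(Ω)` vanishing on all electrodes. -/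
def Vtilde (Ω : Set (E n)) {k : ℕ} (Γ Γ₀ : Fin k → Set (E n)) : Set (H1 Ω) :=
  {v | ∃ g : Lp ℝ 2 (surfaceMeasure Ω), HasTrace v g ∧
    (g =ᵐ[(surfaceMeasure Ω).restrict (⋃ i, (Γ i ∪ Γ₀ i))] 0)}

/-- The bilinear form `a(v, h) = ∫_Ω ε ∇v · ∇h dx`. -/
def form {Ω : Set (E n)} (ε : E n → ℝ) (v h : H1 Ω) : ℝ :=
  ∫ x in Ω, ε x * inner ℝ (grad v x) (grad h x)

/-- `u ∈ Ṽ` and `a(u, h) = -a(θ', h)` for all `h ∈ Ṽ`. -/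
def SolvesVariational {Ω : Set (E n)} {k : ℕ} (Γ Γ₀ : Fin k → Set (E n)) (ε : E n → ℝ)
    (θ' u : H1 Ω) : Prop :=
  u ∈ Vtilde Ω Γ Γ₀ ∧ ∀ h ∈ Vtilde Ω Γ Γ₀, form ε u h = - form ε θ' h

/-- `θ ∈ H¹(Ω)` is a generalized solution of the mixed problem `div (ε ∇θ) = 0` in `Ω`, `θ = Uᵢ`
on `Γᵢ`, `θ = 0` on `Γᵢ₀`, `ν · ε ∇θ = 0` on the rest of the boundary. By Green's formula the
equation and the Neumann condition together are expressed by the integral identity. -/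
def IsGeneralizedSolution {Ω : Set (E n)} {k : ℕ} (Γ Γ₀ : Fin k → Set (E n)) (ε : E n → ℝ)
    (U : ∀ i, Lp ℝ 2 ((surfaceMeasure Ω).restrict (Γ i))) (θ : H1 Ω) : Prop :=
  DirichletData Γ Γ₀ U θ ∧ ∀ h ∈ Vtilde Ω Γ Γ₀, form ε θ h = 0

end Electrostatics

end

/-!
Call a measure on pairs of points a Poincaré coupling in `Ω` if it bounds the mean square of
`φ x - φ y` by the Dirichlet energy of `φ`, for all `C¹` functions `φ`. Couplings compose by the
triangle inequality, so chains of overlapping balls couple any two interior balls of the connected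
set `Ω`. Sliding vertically off the Lipschitz graph couples the part of `Ω` near a boundary point,
and then the surface measure, to an interior ball. By compactness `Ω` and its boundary are coupled
with each other, which contains both the trace inequality and the Friedrichs inequality
`‖v‖² ≤ C (‖∇v‖² + ‖v|_Γ‖²)`; no compact embedding is involved. Density carries the two inequalities
over to `H¹(Ω)`: by the first one `Ṽ` is closed, by the second one the form `a` is coercive on `Ṽ`,
and the Lax–Milgram theorem applies. Dirichlet data are attained one electrode at a time, because an
element of `H₀₀^{1/2}(Γᵢ)` extends by zero to the other electrodes.
-/

noncomputable section

namespace Electrostatics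

/-! ### Poincaré couplings -/

section Coupling

lemma enorm_add_sq_le {F : Type*} [TopologicalSpace F] [ESeminormedAddMonoid F] (a b : F) :
    ‖a + b‖ₑ ^ 2 ≤ 2 * ‖a‖ₑ ^ 2 + 2 * ‖b‖ₑ ^ 2 := by
  have h := ENNReal.rpow_add_le_mul_rpow_add_rpow ‖a‖ₑ ‖b‖ₑ one_le_two
  norm_num [mul_add] at h
  exact (pow_le_pow_left' (enorm_add_le a b) 2).trans h

lemma lintegral_sq_le {α : Type*} [MeasurableSpace α] {μ : Measure α} {g : α → ℝ≥0∞}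
    (hg : AEMeasurable g μ) : (∫⁻ x, g x ∂μ) ^ 2 ≤ μ univ * ∫⁻ x, g x ^ 2 ∂μ := by
  have h := ENNReal.lintegral_mul_le_Lp_mul_Lq μ Real.HolderConjugate.two_two hg
    (aemeasurable_const (b := (1 : ℝ≥0∞)))
  simp only [Pi.mul_apply, mul_one, ENNReal.one_rpow, lintegral_const, one_mul] at h
  calc (∫⁻ x, g x ∂μ) ^ 2
      ≤ ((∫⁻ x, g x ^ (2 : ℝ) ∂μ) ^ (1 / 2 : ℝ) * μ univ ^ (1 / 2 : ℝ)) ^ 2 := by gcongr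
    _ = μ univ * ∫⁻ x, g x ^ 2 ∂μ := by
      rw [mul_pow, ← ENNReal.rpow_natCast, ← ENNReal.rpow_natCast, ← ENNReal.rpow_mul,
        ← ENNReal.rpow_mul]
      norm_num
      rw [mul_comm]

lemma lintegral_le_of_le_smul {α : Type*} [MeasurableSpace α] {μ ν : Measure α} {c : ℝ≥0∞}
    (h : μ ≤ c • ν) (f : α → ℝ≥0∞) : ∫⁻ x, f x ∂μ ≤ c * ∫⁻ x, f x ∂ν :=
  (lintegral_mono' h le_rfl).trans_eq (lintegral_smul_measure c f)

lemma map_le_smul_restrict {α β : Type*} [MeasurableSpace α] [MeasurableSpace β] {μ μ' : Measure α}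
    {ν : Measure β} {f : α → β} (hf : Measurable f) {s : Set β} (hs : MeasurableSet s)
    (hμ : μ ≤ μ') (hμs : ∀ᵐ a ∂μ, f a ∈ s) {c : ℝ≥0∞} (h : μ'.map f ≤ c • ν) :
    μ.map f ≤ c • ν.restrict s := by
  rw [← Measure.restrict_eq_self_of_ae_mem ((ae_map_iff hf.aemeasurable hs).2 hμs),
    ← Measure.restrict_smul]
  exact Measure.restrict_mono le_rfl ((Measure.map_mono hμ hf).trans h)

lemma enorm_sub_sq_le_lintegral_deriv {F : Type*} [NormedAddCommGroup F] [NormedSpace ℝ F]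
    [CompleteSpace F] {f : ℝ → F} (hf : ContDiff ℝ 1 f) {s : ℝ} (hs : 0 ≤ s) :
    ‖f s - f 0‖ₑ ^ 2 ≤ ENNReal.ofReal s * ∫⁻ t in Ioc 0 s, ‖deriv f t‖ₑ ^ 2 := by
  have hc : Continuous (deriv f) := hf.continuous_deriv (by simp)
  have ftc : ∫ t in Ioc 0 s, deriv f t = f s - f 0 := by
    rw [← intervalIntegral.integral_of_le hs]
    exact intervalIntegral.integral_deriv_eq_sub
      (fun x _ => (hf.differentiable (by simp)).differentiableAt) (hc.intervalIntegrable _ _)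
  calc ‖f s - f 0‖ₑ ^ 2 ≤ (∫⁻ t in Ioc 0 s, ‖deriv f t‖ₑ) ^ 2 := by
        rw [← ftc]
        gcongr
        exact enorm_integral_le_lintegral_enorm _
    _ ≤ ENNReal.ofReal s * ∫⁻ t in Ioc 0 s, ‖deriv f t‖ₑ ^ 2 := by
        simpa using lintegral_sq_le (μ := volume.restrict (Ioc 0 s))
          hc.enorm.measurable.aemeasurable

variable {X : Type*} [NormedAddCommGroup X] [NormedSpace ℝ X]

lemma enorm_sub_sq_le_lintegral_fderiv {φ : X → ℝ} (hφ : ContDiff ℝ 1 φ) (x e : X) {s : ℝ}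
    (hs : 0 ≤ s) :
    ‖φ (x + s • e) - φ x‖ₑ ^ 2 ≤
      ENNReal.ofReal s * (‖e‖ₑ ^ 2 * ∫⁻ t in Ioc 0 s, ‖fderiv ℝ φ (x + t • e)‖ₑ ^ 2) := by
  have hline (t : ℝ) : HasDerivAt (fun t : ℝ => x + t • e) e t := by
    simpa using ((hasDerivAt_id t).smul_const e).const_add x
  have hderiv (t : ℝ) : deriv (fun t : ℝ => φ (x + t • e)) t = fderiv ℝ φ (x + t • e) e :=
    ((hφ.differentiable (by simp) _).hasFDerivAt.comp_hasDerivAt t (hline t)).deriv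
  have h := enorm_sub_sq_le_lintegral_deriv (f := fun t : ℝ => φ (x + t • e)) (by fun_prop) hs
  simp only [zero_smul, add_zero, hderiv] at h
  refine h.trans ?_
  gcongr
  rw [← lintegral_const_mul' _ _ (by simp)]
  gcongr with t
  rw [← mul_pow, mul_comm]
  gcongr
  exact ContinuousLinearMap.le_opENorm _ _

variable [MeasureSpace X]

/-- The Dirichlet energy `∫_Ω |∇φ|²`. -/
def energy (Ω : Set X) (φ : X → ℝ) : ℝ≥0∞ :=
  ∫⁻ x in Ω, ‖fderiv ℝ φ x‖ₑ ^ 2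

/-- A measure `π` on pairs of points is a Poincaré coupling in `Ω` if the mean square of
`φ x - φ y` under `π` is controlled by the Dirichlet energy, uniformly over all `C¹` functions. -/
def IsPoincareCoupling (Ω : Set X) (π : Measure (X × X)) : Prop :=
  ∃ C : ℝ≥0∞, C ≠ ⊤ ∧
    ∀ φ : X → ℝ, ContDiff ℝ 1 φ → ∫⁻ p, ‖φ p.1 - φ p.2‖ₑ ^ 2 ∂π ≤ C * energy Ω φ

lemma measurable_enorm_sub_sq [BorelSpace X] [SecondCountableTopology X] {φ : X → ℝ}
    (hφ : ContDiff ℝ 1 φ) : Measurable fun p : X × X => ‖φ p.1 - φ p.2‖ₑ ^ 2 :=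
  (hφ.continuous.fst'.sub hφ.continuous.snd').enorm.measurable.pow_const 2

lemma measurable_enorm_fderiv_sq [BorelSpace X] {φ : X → ℝ} (hφ : ContDiff ℝ 1 φ) :
    Measurable fun x => ‖fderiv ℝ φ x‖ₑ ^ 2 :=
  (hφ.continuous_fderiv (by simp)).enorm.measurable.pow_const 2

namespace IsPoincareCoupling

variable {Ω : Set X}

lemma mono {π π' : Measure (X × X)} (h : IsPoincareCoupling Ω π') {c : ℝ≥0∞} (hc : c ≠ ⊤)
    (hπ : π ≤ c • π') : IsPoincareCoupling Ω π := by
  obtain ⟨C, hC, hπ'⟩ := h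
  refine ⟨c * C, by finiteness, fun φ hφ => (lintegral_le_of_le_smul hπ _).trans ?_⟩
  rw [mul_assoc]
  gcongr
  exact hπ' φ hφ

lemma add {π π' : Measure (X × X)} (h : IsPoincareCoupling Ω π) (h' : IsPoincareCoupling Ω π') :
    IsPoincareCoupling Ω (π + π') := by
  obtain ⟨C, hC, hπ⟩ := h
  obtain ⟨D, hD, hπ'⟩ := h'
  refine ⟨C + D, by finiteness, fun φ hφ => ?_⟩
  rw [lintegral_add_measure, add_mul]
  exact add_le_add (hπ φ hφ) (hπ' φ hφ)

lemma zero : IsPoincareCoupling Ω 0 := ⟨0, by simp, fun φ _ => by simp⟩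

lemma mono_restrict {μ κ : Measure X} [SFinite κ] {s t : Set X} (hst : s ⊆ t)
    (h : IsPoincareCoupling Ω ((μ.restrict t).prod κ)) :
    IsPoincareCoupling Ω ((μ.restrict s).prod κ) := by
  refine h.mono ENNReal.one_ne_top ?_
  rw [one_smul]
  exact Measure.prod_mono (Measure.restrict_mono hst le_rfl) le_rfl

lemma restrict_of_isCompact {μ κ : Measure X} [SFinite μ] [SFinite κ] {K : Set X} (hK : IsCompact K)
    (h : ∀ x ∈ K, ∃ t ∈ 𝓝[K] x, IsPoincareCoupling Ω ((μ.restrict t).prod κ)) :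
    IsPoincareCoupling Ω ((μ.restrict K).prod κ) := by
  refine hK.induction_on (p := fun s => IsPoincareCoupling Ω ((μ.restrict s).prod κ))
    ?_ (fun s t hst => mono_restrict hst) (fun s t hs ht => ?_) h
  · rw [Measure.restrict_empty, Measure.zero_prod]
    exact zero
  · refine (hs.add ht).mono ENNReal.one_ne_top ?_
    rw [one_smul, ← Measure.add_prod]
    exact Measure.prod_mono (Measure.restrict_union_le s t) le_rfl

variable [BorelSpace X] [SecondCountableTopology X]

lemma triangle {α : Type*} [MeasurableSpace α] {m : Measure α} {p q r : α → X}
    (hp : Measurable p) (hq : Measurable q) (hr : Measurable r)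
    (hpq : IsPoincareCoupling Ω (m.map fun a => (p a, q a)))
    (hqr : IsPoincareCoupling Ω (m.map fun a => (q a, r a))) :
    IsPoincareCoupling Ω (m.map fun a => (p a, r a)) := by
  obtain ⟨C, hC, hpq⟩ := hpq
  obtain ⟨D, hD, hqr⟩ := hqr
  refine ⟨2 * C + 2 * D, by finiteness, fun φ hφ => ?_⟩
  have hφm := measurable_enorm_sub_sq hφ
  specialize hpq φ hφ
  specialize hqr φ hφ
  rw [lintegral_map hφm (by fun_prop)] at hpq hqr ⊢
  calc ∫⁻ a, ‖φ (p a) - φ (r a)‖ₑ ^ 2 ∂m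
      ≤ ∫⁻ a, (2 * ‖φ (p a) - φ (q a)‖ₑ ^ 2 + 2 * ‖φ (q a) - φ (r a)‖ₑ ^ 2) ∂m := by
        gcongr with a
        simpa using enorm_add_sq_le (φ (p a) - φ (q a)) (φ (q a) - φ (r a))
    _ = 2 * ∫⁻ a, ‖φ (p a) - φ (q a)‖ₑ ^ 2 ∂m + 2 * ∫⁻ a, ‖φ (q a) - φ (r a)‖ₑ ^ 2 ∂m := by
        have hpqm : Measurable fun a => ‖φ (p a) - φ (q a)‖ₑ ^ 2 := hφm.comp (hp.prodMk hq)
        rw [lintegral_add_left (hpqm.const_mul 2), lintegral_const_mul' _ _ (by simp),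
          lintegral_const_mul' _ _ (by simp)]
    _ ≤ 2 * (C * energy Ω φ) + 2 * (D * energy Ω φ) := by gcongr
    _ = (2 * C + 2 * D) * energy Ω φ := by ring

lemma symm {μ ν : Measure X} [SFinite μ] [SFinite ν] (h : IsPoincareCoupling Ω (μ.prod ν)) :
    IsPoincareCoupling Ω (ν.prod μ) := by
  obtain ⟨C, hC, h⟩ := h
  refine ⟨C, hC, fun φ hφ => ?_⟩
  rw [← Measure.prod_swap, lintegral_map (measurable_enorm_sub_sq hφ) measurable_swap]
  simpa only [Prod.fst_swap, Prod.snd_swap, enorm_sub_rev] using h φ hφ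

lemma fst_prod {π : Measure (X × X)} [SFinite π] {ν κ : Measure X} [SFinite ν] [IsFiniteMeasure κ]
    {c : ℝ≥0∞} (hc : c ≠ ⊤) (hπ : IsPoincareCoupling Ω π) (hν : π.snd ≤ c • ν)
    (hνκ : IsPoincareCoupling Ω (ν.prod κ)) : IsPoincareCoupling Ω (π.fst.prod κ) := by
  have hpair : (π.prod κ).map (fun a => (a.1.1, a.1.2)) = κ univ • π := Measure.map_fst_prod
  have hfst : π.fst.prod κ = (π.prod κ).map fun a => (a.1.1, a.2) := by
    have h := Measure.map_prod_map π κ measurable_fst measurable_id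
    rwa [Measure.map_id] at h
  have hsnd : π.snd.prod κ = (π.prod κ).map fun a => (a.1.2, a.2) := by
    have h := Measure.map_prod_map π κ measurable_snd measurable_id
    rwa [Measure.map_id] at h
  rw [hfst]
  refine triangle (q := fun a => a.1.2) (by fun_prop) (by fun_prop) (by fun_prop)
    (hπ.mono (measure_ne_top κ univ) hpair.le) (hνκ.mono hc ?_)
  rw [← hsnd, ← Measure.prod_smul_left]
  exact Measure.prod_mono hν le_rfl

lemma trans {μ ν κ : Measure X} [IsFiniteMeasure μ] [IsFiniteMeasure ν] [IsFiniteMeasure κ]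
    (hμν : IsPoincareCoupling Ω (μ.prod ν)) (hνκ : IsPoincareCoupling Ω (ν.prod κ)) (hν : ν ≠ 0) :
    IsPoincareCoupling Ω (μ.prod κ) := by
  have hν0 : ν univ ≠ 0 := Measure.measure_univ_ne_zero.2 hν
  have h := hμν.fst_prod (measure_ne_top μ univ) Measure.map_snd_prod.le hνκ
  have hfst : (μ.prod ν).fst = ν univ • μ := Measure.map_fst_prod
  refine h.mono (ENNReal.inv_ne_top.2 hν0) ?_
  rw [hfst, Measure.prod_smul_left, smul_smul, ENNReal.inv_mul_cancel hν0 (measure_ne_top ν univ),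
    one_smul]

lemma lintegral_sq_le {μ ν : Measure X} [IsFiniteMeasure μ]
    [IsFiniteMeasure ν] (h : IsPoincareCoupling Ω (μ.prod ν)) (hν : ν ≠ 0) :
    ∃ C : ℝ≥0∞, C ≠ ⊤ ∧ ∀ φ : X → ℝ, ContDiff ℝ 1 φ →
      ∫⁻ x, ‖φ x‖ₑ ^ 2 ∂μ ≤ C * (energy Ω φ + ∫⁻ x, ‖φ x‖ₑ ^ 2 ∂ν) := by
  obtain ⟨C, hC, h⟩ := h
  have hν0 : ν univ ≠ 0 := Measure.measure_univ_ne_zero.2 hν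
  refine ⟨(ν univ)⁻¹ * (2 * C + 2 * μ univ),
    ENNReal.mul_ne_top (ENNReal.inv_ne_top.2 hν0) (by finiteness), fun φ hφ => ?_⟩
  have hm : Measurable fun x => ‖φ x‖ₑ ^ 2 := hφ.continuous.enorm.measurable.pow_const 2
  have hfst : ∫⁻ p, ‖φ p.1‖ₑ ^ 2 ∂μ.prod ν = ν univ * ∫⁻ x, ‖φ x‖ₑ ^ 2 ∂μ := by
    rw [← lintegral_map hm measurable_fst, Measure.map_fst_prod, lintegral_smul_measure,
      smul_eq_mul]
  have hsnd : ∫⁻ p, ‖φ p.2‖ₑ ^ 2 ∂μ.prod ν = μ univ * ∫⁻ x, ‖φ x‖ₑ ^ 2 ∂ν := by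
    rw [← lintegral_map hm measurable_snd, Measure.map_snd_prod, lintegral_smul_measure,
      smul_eq_mul]
  have key : ν univ * ∫⁻ x, ‖φ x‖ₑ ^ 2 ∂μ ≤
      (2 * C + 2 * μ univ) * (energy Ω φ + ∫⁻ x, ‖φ x‖ₑ ^ 2 ∂ν) := by
    calc ν univ * ∫⁻ x, ‖φ x‖ₑ ^ 2 ∂μ
        ≤ ∫⁻ p, (2 * ‖φ p.1 - φ p.2‖ₑ ^ 2 + 2 * ‖φ p.2‖ₑ ^ 2) ∂μ.prod ν := by
          rw [← hfst]
          gcongr with p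
          simpa using enorm_add_sq_le (φ p.1 - φ p.2) (φ p.2)
      _ = 2 * ∫⁻ p, ‖φ p.1 - φ p.2‖ₑ ^ 2 ∂μ.prod ν + 2 * (μ univ * ∫⁻ x, ‖φ x‖ₑ ^ 2 ∂ν) := by
          rw [lintegral_add_left ((measurable_enorm_sub_sq hφ).const_mul 2),
            lintegral_const_mul' _ _ (by simp), lintegral_const_mul' _ _ (by simp), hsnd]
      _ ≤ 2 * (C * energy Ω φ) + 2 * (μ univ * ∫⁻ x, ‖φ x‖ₑ ^ 2 ∂ν) := by
          gcongr
          exact h φ hφ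
      _ ≤ (2 * C + 2 * μ univ) * (energy Ω φ + ∫⁻ x, ‖φ x‖ₑ ^ 2 ∂ν) := by
          rw [add_mul, ← mul_assoc, ← mul_assoc]
          gcongr
          · exact le_self_add
          · exact le_add_self
  rw [mul_assoc]
  exact (ENNReal.mul_le_iff_le_inv hν0 (measure_ne_top ν univ)).1 key

end IsPoincareCoupling

end Coupling

section Slide

lemma restrict_ball_ne_zero {X : Type*} [PseudoMetricSpace X] [MeasurableSpace X] (μ : Measure X)
    [μ.IsOpenPosMeasure] (x : X) {r : ℝ} (hr : 0 < r) : μ.restrict (Metric.ball x r) ≠ 0 := by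
  rw [Ne, Measure.restrict_eq_zero]
  exact (Metric.measure_ball_pos μ x hr).ne'

instance isFiniteMeasure_restrict_ball {X : Type*} [PseudoMetricSpace X] [ProperSpace X]
    [MeasurableSpace X] (μ : Measure X) [IsFiniteMeasureOnCompacts μ] (x : X) (r : ℝ) :
    IsFiniteMeasure (μ.restrict (Metric.ball x r)) :=
  isFiniteMeasure_restrict.2 measure_ball_lt_top.ne

variable {X : Type*} [NormedAddCommGroup X] [NormedSpace ℝ X] [MeasureSpace X] [BorelSpace X]
  [SecondCountableTopology X] {Ω : Set X}

lemma map_prod_add_smul_le (hΩ : MeasurableSet Ω) {σ σ' : Measure X} [SFinite σ] [SFinite σ']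
    {e : X} {s : ℝ} {c : ℝ≥0∞} (hσ : σ ≤ σ') (hσΩ : ∀ᵐ x ∂σ, ∀ t ∈ Ioc 0 s, x + t • e ∈ Ω)
    (h : (σ'.prod (volume.restrict (Ioc 0 s))).map (fun a => a.1 + a.2 • e) ≤ c • volume) :
    (σ.prod (volume.restrict (Ioc 0 s))).map (fun a => a.1 + a.2 • e) ≤
      c • volume.restrict Ω := by
  have hmap : Measurable fun a : X × ℝ => a.1 + a.2 • e := by fun_prop
  refine map_le_smul_restrict hmap hΩ (Measure.prod_mono hσ le_rfl) ?_ h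
  rw [Measure.ae_prod_iff_ae_ae (hmap hΩ)]
  filter_upwards [hσΩ] with x hx
  exact ae_restrict_of_forall_mem measurableSet_Ioc hx

/- The hypothesis says that the segments `{x + t • e | 0 < t ≤ s}`, with starting points `x`
distributed according to `σ`, sweep out `Ω` with density at most `c`. -/
lemma lintegral_enorm_sub_sq_le_of_map_le {σ : Measure X} [SFinite σ] {e : X} {s : ℝ} (hs : 0 ≤ s)
    {c : ℝ≥0∞} (h : (σ.prod (volume.restrict (Ioc 0 s))).map (fun a => a.1 + a.2 • e) ≤
      c • volume.restrict Ω) {φ : X → ℝ} (hφ : ContDiff ℝ 1 φ) :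
    ∫⁻ x, ‖φ (x + s • e) - φ x‖ₑ ^ 2 ∂σ ≤ ENNReal.ofReal s * (‖e‖ₑ ^ 2 * (c * energy Ω φ)) := by
  have hm := measurable_enorm_fderiv_sq hφ
  have hmap : Measurable fun a : X × ℝ => a.1 + a.2 • e := by fun_prop
  have hcomp : Measurable fun a : X × ℝ => ‖fderiv ℝ φ (a.1 + a.2 • e)‖ₑ ^ 2 := hm.comp hmap
  calc ∫⁻ x, ‖φ (x + s • e) - φ x‖ₑ ^ 2 ∂σ
      ≤ ∫⁻ x, ENNReal.ofReal s *
          (‖e‖ₑ ^ 2 * ∫⁻ t in Ioc 0 s, ‖fderiv ℝ φ (x + t • e)‖ₑ ^ 2) ∂σ := by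
        gcongr with x
        exact enorm_sub_sq_le_lintegral_fderiv hφ x e hs
    _ = ENNReal.ofReal s * (‖e‖ₑ ^ 2 * ∫⁻ y, ‖fderiv ℝ φ y‖ₑ ^ 2
          ∂(σ.prod (volume.restrict (Ioc 0 s))).map (fun a => a.1 + a.2 • e)) := by
        rw [lintegral_const_mul' _ _ (by simp), lintegral_const_mul' _ _ (by simp),
          lintegral_map hm hmap, lintegral_prod _ hcomp.aemeasurable]
    _ ≤ ENNReal.ofReal s * (‖e‖ₑ ^ 2 * (c * energy Ω φ)) := by
        gcongr
        exact lintegral_le_of_le_smul h _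

namespace IsPoincareCoupling

lemma map_add_smul {σ : Measure X} [SFinite σ] {e : X} {s : ℝ} (hs : 0 ≤ s) {c : ℝ≥0∞}
    (hc : c ≠ ⊤) (h : (σ.prod (volume.restrict (Ioc 0 s))).map (fun a => a.1 + a.2 • e) ≤
      c • volume.restrict Ω) :
    IsPoincareCoupling Ω (σ.map fun x => (x, x + s • e)) := by
  refine ⟨ENNReal.ofReal s * (‖e‖ₑ ^ 2 * c), by finiteness, fun φ hφ => ?_⟩
  rw [lintegral_map (measurable_enorm_sub_sq hφ) (by fun_prop)]
  simpa only [enorm_sub_rev, mul_assoc] using lintegral_enorm_sub_sq_le_of_map_le hs h hφ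

lemma map_prod_add_smul {σ : Measure X} [SFinite σ] {e : X} {s : ℝ} {c : ℝ≥0∞} (hc : c ≠ ⊤)
    (h : (σ.prod (volume.restrict (Ioc 0 s))).map (fun a => a.1 + a.2 • e) ≤
      c • volume.restrict Ω) :
    IsPoincareCoupling Ω
      ((σ.prod (volume.restrict (Ioc 0 s))).map fun a => (a.1, a.1 + a.2 • e)) := by
  refine ⟨ENNReal.ofReal s * (ENNReal.ofReal s * (‖e‖ₑ ^ 2 * c)), by finiteness, fun φ hφ => ?_⟩
  have hpair : Measurable fun a : X × ℝ => (a.1, a.1 + a.2 • e) := by fun_prop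
  have hφm : Measurable φ := hφ.continuous.measurable
  have hm : Measurable fun a : X × ℝ => ‖φ a.1 - φ (a.1 + a.2 • e)‖ₑ ^ 2 := by fun_prop
  have hslide {t : ℝ} (ht : t ∈ Ioc 0 s) : ∫⁻ x, ‖φ x - φ (x + t • e)‖ₑ ^ 2 ∂σ ≤
      ENNReal.ofReal s * (‖e‖ₑ ^ 2 * (c * energy Ω φ)) := by
    have hsub : (σ.prod (volume.restrict (Ioc 0 t))).map (fun a => a.1 + a.2 • e) ≤
        c • volume.restrict Ω := by
      refine (Measure.map_mono (Measure.prod_mono le_rfl ?_) (by fun_prop)).trans h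
      exact Measure.restrict_mono (Ioc_subset_Ioc_right ht.2) le_rfl
    simp only [enorm_sub_rev (φ _) (φ (_ + t • e))]
    refine (lintegral_enorm_sub_sq_le_of_map_le ht.1.le hsub hφ).trans ?_
    gcongr
    exact ht.2
  calc ∫⁻ p, ‖φ p.1 - φ p.2‖ₑ ^ 2
        ∂(σ.prod (volume.restrict (Ioc 0 s))).map (fun a => (a.1, a.1 + a.2 • e))
      = ∫⁻ t in Ioc 0 s, ∫⁻ x, ‖φ x - φ (x + t • e)‖ₑ ^ 2 ∂σ := by
        rw [lintegral_map (measurable_enorm_sub_sq hφ) hpair]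
        exact lintegral_prod_symm _ hm.aemeasurable
    _ ≤ ∫⁻ _ in Ioc 0 s, ENNReal.ofReal s * (‖e‖ₑ ^ 2 * (c * energy Ω φ)) :=
        setLIntegral_mono' measurableSet_Ioc fun t ht => hslide ht
    _ = ENNReal.ofReal s * (ENNReal.ofReal s * (‖e‖ₑ ^ 2 * c)) * energy Ω φ := by
        rw [setLIntegral_const, Real.volume_Ioc, sub_zero]
        ring

lemma prod_of_translate {σ ν κ : Measure X} [SFinite σ] [SFinite ν] [IsFiniteMeasure κ] {e : X}
    {s : ℝ} (hs : 0 ≤ s) {c c' : ℝ≥0∞} (hc : c ≠ ⊤) (hc' : c' ≠ ⊤)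
    (h : (σ.prod (volume.restrict (Ioc 0 s))).map (fun a => a.1 + a.2 • e) ≤
      c • volume.restrict Ω)
    (hν : σ.map (· + s • e) ≤ c' • ν) (hνκ : IsPoincareCoupling Ω (ν.prod κ)) :
    IsPoincareCoupling Ω (σ.prod κ) := by
  have hfst : (σ.map fun x => (x, x + s • e)).fst = σ := by
    rw [Measure.fst_map_prodMk (by fun_prop), Measure.map_id']
  have hsnd : (σ.map fun x => (x, x + s • e)).snd = σ.map (· + s • e) :=
    Measure.snd_map_prodMk measurable_id
  rw [← hfst]
  exact (map_add_smul hs hc h).fst_prod hc' (hsnd.trans_le hν) hνκ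

lemma prod_of_slide {σ κ : Measure X} [SFinite σ] [IsFiniteMeasure κ] {e : X} {s : ℝ}
    (hs : 0 < s) {c : ℝ≥0∞} (hc : c ≠ ⊤)
    (h : (σ.prod (volume.restrict (Ioc 0 s))).map (fun a => a.1 + a.2 • e) ≤
      c • volume.restrict Ω)
    [SFinite (volume.restrict Ω)] (hκ : IsPoincareCoupling Ω ((volume.restrict Ω).prod κ)) :
    IsPoincareCoupling Ω (σ.prod κ) := by
  set m := σ.prod (volume.restrict (Ioc 0 s)) with hm
  have hfst : (m.map fun a => (a.1, a.1 + a.2 • e)).fst = ENNReal.ofReal s • σ := by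
    rw [Measure.fst_map_prodMk (by fun_prop), hm, Measure.map_fst_prod, Measure.restrict_apply_univ,
      Real.volume_Ioc, sub_zero]
  have hsnd : (m.map fun a => (a.1, a.1 + a.2 • e)).snd = m.map fun a => a.1 + a.2 • e :=
    Measure.snd_map_prodMk measurable_fst
  have hs0 : ENNReal.ofReal s ≠ 0 := by simpa using hs
  refine ((map_prod_add_smul hc h).fst_prod hc (hsnd.trans_le h) hκ).mono
    (ENNReal.inv_ne_top.2 hs0) ?_
  rw [hfst, Measure.prod_smul_left, smul_smul, ENNReal.inv_mul_cancel hs0 ENNReal.ofReal_ne_top,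
    one_smul]

end IsPoincareCoupling

section AddHaar

variable [FiniteDimensional ℝ X] [(volume : Measure X).IsAddHaarMeasure]

lemma map_prod_add_smul_volume (κ : Measure ℝ) [SFinite κ] (e : X) :
    ((volume : Measure X).prod κ).map (fun a => a.1 + a.2 • e) = κ univ • volume := by
  have hmap : Measurable fun a : X × ℝ => a.1 + a.2 • e := by fun_prop
  ext s hs
  rw [Measure.map_apply hmap hs, Measure.prod_apply_symm (hmap hs)]
  simp [preimage_preimage, measure_preimage_add_right, mul_comm]

lemma map_restrict_prod_add_smul_le {A : Set X} (hA : MeasurableSet A) (hΩ : MeasurableSet Ω)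
    {e : X} {s : ℝ} (h : ∀ x ∈ A, ∀ t ∈ Ioc 0 s, x + t • e ∈ Ω) :
    ((volume.restrict A).prod (volume.restrict (Ioc 0 s))).map (fun a => a.1 + a.2 • e) ≤
      ENNReal.ofReal s • volume.restrict Ω := by
  refine map_prod_add_smul_le hΩ Measure.restrict_le_self (ae_restrict_of_forall_mem hA h) ?_
  simp [map_prod_add_smul_volume]

lemma setLIntegral_enorm_add_sub_sq_le {A : Set X} (hA : MeasurableSet A) (hΩ : MeasurableSet Ω)
    {h : X} (hAΩ : ∀ x ∈ A, ∀ t ∈ Ioc (0 : ℝ) 1, x + t • h ∈ Ω) {φ : X → ℝ}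
    (hφ : ContDiff ℝ 1 φ) :
    ∫⁻ x in A, ‖φ (x + h) - φ x‖ₑ ^ 2 ≤ ‖h‖ₑ ^ 2 * energy Ω φ := by
  simpa using lintegral_enorm_sub_sq_le_of_map_le zero_le_one
    (map_restrict_prod_add_smul_le hA hΩ hAΩ) hφ

lemma lintegral_enorm_sub_sq_prod_restrict {B : Set X} (hB : MeasurableSet B) {φ : X → ℝ}
    (hφ : ContDiff ℝ 1 φ) :
    ∫⁻ p, ‖φ p.1 - φ p.2‖ₑ ^ 2 ∂(volume.restrict B).prod (volume.restrict B) =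
      ∫⁻ h, ∫⁻ x in {x | x ∈ B ∧ x + h ∈ B}, ‖φ (x + h) - φ x‖ₑ ^ 2 := by
  set S : Set (X × X) := {a | a.1 ∈ B ∧ a.1 + a.2 ∈ B}
  have hS : MeasurableSet S := (measurable_fst hB).inter (measurable_add hB)
  have hm := measurable_enorm_sub_sq hφ
  have hshear : MeasurePreserving (fun a : X × X => (a.1, a.1 + a.2)) (volume.prod volume)
    (volume.prod volume) := measurePreserving_prod_add volume volume
  have hslice (h : X) : ∫⁻ x, S.indicator (fun a => ‖φ a.1 - φ (a.1 + a.2)‖ₑ ^ 2) (x, h) =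
      ∫⁻ x in {x | x ∈ B ∧ x + h ∈ B}, ‖φ (x + h) - φ x‖ₑ ^ 2 := by
    have hSh : MeasurableSet {x | x ∈ B ∧ x + h ∈ B} := measurable_prodMk_right hS
    rw [← lintegral_indicator hSh]
    simp only [enorm_sub_rev (φ (_ + h))]
    rfl
  calc ∫⁻ p, ‖φ p.1 - φ p.2‖ₑ ^ 2 ∂(volume.restrict B).prod (volume.restrict B)
      = ∫⁻ a in S, ‖φ a.1 - φ (a.1 + a.2)‖ₑ ^ 2 ∂(volume.prod volume) := by
        rw [Measure.prod_restrict]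
        exact (hshear.setLIntegral_comp_preimage (hB.prod hB) hm).symm
    _ = ∫⁻ h, ∫⁻ x, S.indicator (fun a => ‖φ a.1 - φ (a.1 + a.2)‖ₑ ^ 2) (x, h) := by
        rw [← lintegral_indicator hS, lintegral_prod_symm]
        exact ((hm.comp hshear.measurable).indicator hS).aemeasurable
    _ = ∫⁻ h, ∫⁻ x in {x | x ∈ B ∧ x + h ∈ B}, ‖φ (x + h) - φ x‖ₑ ^ 2 :=
        lintegral_congr hslice

lemma isPoincareCoupling_of_convex {B : Set X} (hΩ : MeasurableSet Ω) (hB : Convex ℝ B)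
    (hBm : MeasurableSet B) (hBb : Bornology.IsBounded B) (hBΩ : B ⊆ Ω) :
    IsPoincareCoupling Ω ((volume.restrict B).prod (volume.restrict B)) := by
  set D : Set X := Metric.closedBall 0 (Metric.diam B)
  have hD : volume D ≠ ⊤ := measure_closedBall_lt_top.ne
  refine ⟨ENNReal.ofReal (Metric.diam B) ^ 2 * volume D, by finiteness, fun φ hφ => ?_⟩
  have hslice (h : X) : ∫⁻ x in {x | x ∈ B ∧ x + h ∈ B}, ‖φ (x + h) - φ x‖ₑ ^ 2 ≤
      D.indicator (fun _ => ENNReal.ofReal (Metric.diam B) ^ 2 * energy Ω φ) h := by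
    have hm : MeasurableSet {x | x ∈ B ∧ x + h ∈ B} :=
      hBm.inter ((measurable_add_const h) hBm)
    by_cases hh : h ∈ D
    · rw [indicator_of_mem hh]
      refine (setLIntegral_enorm_add_sub_sq_le hm hΩ
        (fun x hx t ht => hBΩ (hB.add_smul_mem hx.1 hx.2 ⟨ht.1.le, ht.2⟩)) hφ).trans ?_
      gcongr
      rw [← ofReal_norm]
      exact ENNReal.ofReal_le_ofReal (mem_closedBall_zero_iff.1 hh)
    · have hempty : {x | x ∈ B ∧ x + h ∈ B} = ∅ := by
        refine eq_empty_of_forall_notMem fun x hx => hh ?_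
        simpa [D, dist_eq_norm] using Metric.dist_le_diam_of_mem hBb hx.2 hx.1
      simp [hempty]
  calc ∫⁻ p, ‖φ p.1 - φ p.2‖ₑ ^ 2 ∂(volume.restrict B).prod (volume.restrict B)
      ≤ ∫⁻ h, D.indicator (fun _ => ENNReal.ofReal (Metric.diam B) ^ 2 * energy Ω φ) h :=
        (lintegral_enorm_sub_sq_prod_restrict hBm hφ).trans_le (lintegral_mono hslice)
    _ = ENNReal.ofReal (Metric.diam B) ^ 2 * volume D * energy Ω φ := by
        rw [lintegral_indicator measurableSet_closedBall, setLIntegral_const]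
        ring

lemma isPoincareCoupling_of_subset_ball (hΩ : IsOpen Ω) {A B : Set X} {z : X} {R : ℝ}
    (hz : Metric.ball z R ⊆ Ω) (hA : A ⊆ Metric.ball z R) (hB : B ⊆ Metric.ball z R) :
    IsPoincareCoupling Ω ((volume.restrict A).prod (volume.restrict B)) :=
  ((isPoincareCoupling_of_convex hΩ.measurableSet (convex_ball z R) measurableSet_ball
    Metric.isBounded_ball hz).mono_restrict hA).symm.mono_restrict hB |>.symm

lemma isPoincareCoupling_concentric_ball (hΩ : IsOpen Ω) {x : X} {r s : ℝ}
    (hr : Metric.ball x r ⊆ Ω) (hs : Metric.ball x s ⊆ Ω) :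
    IsPoincareCoupling Ω
      ((volume.restrict (Metric.ball x r)).prod (volume.restrict (Metric.ball x s))) := by
  rcases le_total r s with h | h
  · exact isPoincareCoupling_of_subset_ball hΩ hs (Metric.ball_subset_ball h) subset_rfl
  · exact isPoincareCoupling_of_subset_ball hΩ hr subset_rfl (Metric.ball_subset_ball h)

lemma isPoincareCoupling_ball (hΩ : IsOpen Ω) (hc : IsPreconnected Ω) {x y : X} {r s : ℝ}
    (hr : 0 < r) (hs : 0 < s) (hx : Metric.ball x r ⊆ Ω) (hy : Metric.ball y s ⊆ Ω) :
    IsPoincareCoupling Ω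
      ((volume.restrict (Metric.ball x r)).prod (volume.restrict (Metric.ball y s))) := by
  let P : X → X → Prop := fun x y => ∀ r s : ℝ, 0 < r → 0 < s → Metric.ball x r ⊆ Ω →
    Metric.ball y s ⊆ Ω → IsPoincareCoupling Ω
      ((volume.restrict (Metric.ball x r)).prod (volume.restrict (Metric.ball y s)))
  refine hc.induction₂ P (fun x hx => ?_) (fun x y z _ hy _ hxy hyz r s hr hs hxr hzs => ?_)
    (fun x y _ _ hxy r s hr hs hxr hys => (hxy s r hs hr hys hxr).symm)
    (hx (Metric.mem_ball_self hr)) (hy (Metric.mem_ball_self hs)) r s hr hs hx hy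
  · obtain ⟨R, hR, hRΩ⟩ := Metric.isOpen_iff.1 hΩ x hx
    filter_upwards [mem_nhdsWithin_of_mem_nhds (Metric.ball_mem_nhds x hR)] with y hy r s _ _
      hxr hys
    obtain ⟨δ, hδ, hδR⟩ := Metric.isOpen_iff.1 Metric.isOpen_ball y hy
    exact ((isPoincareCoupling_concentric_ball hΩ hxr hRΩ).trans
      (isPoincareCoupling_of_subset_ball hΩ hRΩ subset_rfl hδR)
      (restrict_ball_ne_zero _ x hR)).trans
      (isPoincareCoupling_concentric_ball hΩ (hδR.trans hRΩ) hys) (restrict_ball_ne_zero _ y hδ)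
  · obtain ⟨R, hR, hRΩ⟩ := Metric.isOpen_iff.1 hΩ y hy
    exact (hxy r R hr hR hxr hRΩ).trans (hyz R s hR hs hRΩ hzs) (restrict_ball_ne_zero _ y hR)

end AddHaar

end Slide

/-! ### Lipschitz boundaries -/

section Coordinates

variable {X Y : Type*} [NormedAddCommGroup X] [InnerProductSpace ℝ X] [NormedAddCommGroup Y]
  [InnerProductSpace ℝ Y] (Φ : X ≃ₗᵢ[ℝ] WithLp 2 (Y × ℝ))

/-- The vertical unit vector of the orthogonal coordinates `Φ`. -/
def vertical : X := Φ.symm (WithLp.toLp 2 (0, 1))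

lemma norm_vertical : ‖vertical Φ‖ = 1 := by simp [vertical]

@[simp]
lemma fst_add_smul_vertical (x : X) (s : ℝ) : (Φ (x + s • vertical Φ)).fst = (Φ x).fst := by
  simp [vertical]

@[simp]
lemma snd_add_smul_vertical (x : X) (s : ℝ) :
    (Φ (x + s • vertical Φ)).snd = (Φ x).snd + s := by
  simp [vertical]

lemma dist_add_smul_vertical (x : X) (s : ℝ) : dist (x + s • vertical Φ) x = |s| := by
  simp [norm_smul, norm_vertical]

lemma dist_fst_le (x y : X) : dist (Φ x).fst (Φ y).fst ≤ dist x y :=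
  (WithLp.dist_fst_le _ _).trans_eq (Φ.dist_map x y)

lemma dist_snd_le (x y : X) : dist (Φ x).snd (Φ y).snd ≤ dist x y :=
  (WithLp.dist_snd_le _ _).trans_eq (Φ.dist_map x y)

/-- The parametrization of the graph of `γ` by the horizontal coordinate. -/
def graphMap (γ : Y → ℝ) (y : Y) : X := Φ.symm (WithLp.toLp 2 (y, γ y))

@[simp]
lemma apply_graphMap (γ : Y → ℝ) (y : Y) : Φ (graphMap Φ γ y) = WithLp.toLp 2 (y, γ y) := by
  simp [graphMap]

lemma graphMap_fst {γ : Y → ℝ} {x : X} (hx : (Φ x).snd = γ (Φ x).fst) :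
    graphMap Φ γ (Φ x).fst = x := by
  rw [graphMap, ← hx]
  exact Φ.symm_apply_apply x

lemma lipschitzWith_graphMap {γ : Y → ℝ} {K : ℝ≥0} (hγ : LipschitzWith K γ) :
    LipschitzWith (1 + K) (graphMap Φ γ) := by
  refine LipschitzWith.of_dist_le_mul fun x y => ?_
  have hsq : dist (γ x) (γ y) ^ 2 ≤ (K * dist x y) ^ 2 :=
    pow_le_pow_left₀ dist_nonneg (hγ.dist_le_mul x y) 2
  have hK : 0 ≤ K * dist x y ^ 2 := by positivity
  rw [← Φ.dist_map, apply_graphMap, apply_graphMap, WithLp.prod_dist_eq_of_L2]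
  refine (Real.sqrt_le_left (by positivity)).2 ?_
  push_cast
  change dist x y ^ 2 + dist (γ x) (γ y) ^ 2 ≤ _
  linarith

lemma map_graphMap_prod_add_smul_vertical [FiniteDimensional ℝ X] [MeasurableSpace X]
    [BorelSpace X] [FiniteDimensional ℝ Y] [MeasurableSpace Y] [BorelSpace Y] {γ : Y → ℝ}
    (hγ : Continuous γ) :
    (((volume : Measure Y).map (graphMap Φ γ)).prod volume).map
      (fun a : X × ℝ => a.1 + a.2 • vertical Φ) = volume := by
  have hshear : MeasurePreserving (fun a : Y × ℝ => (a.1, a.2 + γ a.1)) volume volume :=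
    (MeasurePreserving.id volume).skew_product (g := fun y t => t + γ y)
      (by fun_prop) (ae_of_all _ fun y => map_add_right_eq_self volume (γ y))
  have hcoord : MeasurePreserving (fun a : Y × ℝ => Φ.symm (WithLp.toLp 2 a)) :=
    Φ.symm.measurePreserving.comp (WithLp.volume_preserving_toLp _ _)
  have hγm : Measurable (graphMap Φ γ) :=
    hcoord.measurable.comp (measurable_id.prodMk hγ.measurable)
  have hslide : (fun a : X × ℝ => a.1 + a.2 • vertical Φ) ∘ Prod.map (graphMap Φ γ) id =
      (fun a : Y × ℝ => Φ.symm (WithLp.toLp 2 a)) ∘ fun a => (a.1, a.2 + γ a.1) := by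
    ext a
    apply Φ.injective
    apply WithLp.ofLp_injective
    simp [vertical, add_comm]
  rw [← Measure.map_id (μ := (volume : Measure ℝ)), Measure.map_prod_map _ _ hγm measurable_id,
    Measure.map_map (by fun_prop) (hγm.prodMap measurable_id), hslide]
  exact (hcoord.comp hshear).map_eq

end Coordinates

/-- In the ball of radius `r` around the boundary point `x₀` the open set `Ω` lies above the graph
of the `K`-Lipschitz function `γ`, in the orthogonal coordinates `Φ`. -/
structure IsLocalGraph {X Y : Type*} [NormedAddCommGroup X] [InnerProductSpace ℝ X]
    [NormedAddCommGroup Y] [InnerProductSpace ℝ Y] (Ω : Set X) (x₀ : X)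
    (Φ : X ≃ₗᵢ[ℝ] WithLp 2 (Y × ℝ)) (γ : Y → ℝ) (K : ℝ≥0) (r : ℝ) : Prop where
  isOpen : IsOpen Ω
  mem_frontier : x₀ ∈ frontier Ω
  lipschitz : LipschitzWith K γ
  mem_iff : ∀ x ∈ Metric.ball x₀ r, x ∈ Ω ↔ γ (Φ x).fst < (Φ x).snd

namespace IsLocalGraph

variable {X Y : Type*} [NormedAddCommGroup X] [InnerProductSpace ℝ X] [NormedAddCommGroup Y]
  [InnerProductSpace ℝ Y] {Φ : X ≃ₗᵢ[ℝ] WithLp 2 (Y × ℝ)} {Ω : Set X} {x₀ : X} {γ : Y → ℝ}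
  {K : ℝ≥0} {r ρ h : ℝ}

lemma le_snd_of_mem_closure (hg : IsLocalGraph Ω x₀ Φ γ K r) {x : X} (hx : x ∈ closure Ω)
    (hxr : x ∈ Metric.ball x₀ r) : γ (Φ x).fst ≤ (Φ x).snd := by
  by_contra! hlt
  have hfst : Continuous fun y => (Φ y).fst := (WithLp.continuous_fst 2 Y ℝ).comp Φ.continuous
  have hsnd : Continuous fun y => (Φ y).snd := (WithLp.continuous_snd 2 Y ℝ).comp Φ.continuous
  have hbelow : IsOpen (Metric.ball x₀ r ∩ {y | (Φ y).snd < γ (Φ y).fst}) :=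
    Metric.isOpen_ball.inter (isOpen_lt hsnd (hg.lipschitz.continuous.comp hfst))
  obtain ⟨y, ⟨hyr, hy⟩, hyΩ⟩ := mem_closure_iff.1 hx _ hbelow ⟨hxr, hlt⟩
  exact lt_asymm ((hg.mem_iff y hyr).1 hyΩ) hy

lemma snd_eq_of_mem_frontier (hg : IsLocalGraph Ω x₀ Φ γ K r) {x : X} (hx : x ∈ frontier Ω)
    (hxr : x ∈ Metric.ball x₀ r) : (Φ x).snd = γ (Φ x).fst := by
  refine le_antisymm (not_lt.1 fun hlt => ?_) (hg.le_snd_of_mem_closure hx.1 hxr)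
  rw [hg.isOpen.frontier_eq] at hx
  exact hx.2 ((hg.mem_iff x hxr).2 hlt)

lemma add_smul_vertical_mem (hg : IsLocalGraph Ω x₀ Φ γ K r) {x : X} {s : ℝ} (hs : 0 < s)
    (hx : γ (Φ x).fst ≤ (Φ x).snd) (hxs : dist x x₀ + s < r) : x + s • vertical Φ ∈ Ω := by
  have htri := dist_triangle (x + s • vertical Φ) x x₀
  rw [dist_add_smul_vertical, abs_of_pos hs] at htri
  rw [hg.mem_iff _ (Metric.mem_ball.2 (by linarith)), fst_add_smul_vertical, snd_add_smul_vertical]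
  exact hx.trans_lt (lt_add_of_pos_right _ hs)

lemma mem_frontier_of_snd_eq (hg : IsLocalGraph Ω x₀ Φ γ K r) {x : X}
    (hx : (Φ x).snd = γ (Φ x).fst) (hxr : x ∈ Metric.ball x₀ r) : x ∈ frontier Ω := by
  rw [hg.isOpen.frontier_eq]
  refine ⟨?_, fun hxΩ => ((hg.mem_iff x hxr).1 hxΩ).ne' hx⟩
  have hlim : Tendsto (fun s : ℝ => x + s • vertical Φ) (𝓝[>] 0) (𝓝 x) := by
    have hcont : Continuous fun s : ℝ => x + s • vertical Φ := by fun_prop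
    simpa using (hcont.tendsto 0).mono_left (nhdsWithin_le_nhds (s := Ioi 0))
  refine mem_closure_of_tendsto hlim ?_
  filter_upwards [Ioo_mem_nhdsGT (sub_pos.2 (Metric.mem_ball.1 hxr))] with s hs
  exact hg.add_smul_vertical_mem hs.1 hx.ge (by linarith [hs.2])

lemma ball_add_smul_vertical_subset (hg : IsLocalGraph Ω x₀ Φ γ K r) (hρ : 0 < ρ)
    (hh : (1 + K) * ρ < h) (hr : h + ρ ≤ r) : Metric.ball (x₀ + h • vertical Φ) ρ ⊆ Ω := by
  intro x hx
  rw [Metric.mem_ball] at hx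
  have hh0 : 0 < h := lt_trans (by positivity) hh
  have hx₀ := hg.snd_eq_of_mem_frontier hg.mem_frontier (Metric.mem_ball_self (by linarith))
  have htri := dist_triangle x (x₀ + h • vertical Φ) x₀
  rw [dist_add_smul_vertical, abs_of_pos hh0] at htri
  rw [hg.mem_iff _ (Metric.mem_ball.2 (by linarith))]
  have hfst := (dist_fst_le Φ x (x₀ + h • vertical Φ)).trans_lt hx
  have hsnd := (dist_snd_le Φ x (x₀ + h • vertical Φ)).trans_lt hx
  rw [fst_add_smul_vertical] at hfst
  rw [snd_add_smul_vertical, Real.dist_eq] at hsnd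
  have hγ : γ (Φ x).fst - γ (Φ x₀).fst ≤ K * ρ :=
    calc γ (Φ x).fst - γ (Φ x₀).fst ≤ dist (γ (Φ x).fst) (γ (Φ x₀).fst) := le_abs_self _
      _ ≤ K * dist (Φ x).fst (Φ x₀).fst := hg.lipschitz.dist_le_mul _ _
      _ ≤ K * ρ := by gcongr
  linarith [(abs_lt.1 hsnd).1]

lemma isPoincareCoupling_ball_inter [FiniteDimensional ℝ X] [MeasurableSpace X] [BorelSpace X]
    (hg : IsLocalGraph Ω x₀ Φ γ K r) (hρ : 0 < ρ) (hh : (1 + K) * ρ < h) (hr : h + ρ ≤ r)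
    {κ : Measure X} [IsFiniteMeasure κ]
    (hκ : IsPoincareCoupling Ω ((volume.restrict (Metric.ball (x₀ + h • vertical Φ) ρ)).prod κ)) :
    IsPoincareCoupling Ω ((volume.restrict (Metric.ball x₀ ρ ∩ Ω)).prod κ) := by
  have hh0 : 0 < h := lt_trans (by positivity) hh
  have hA : MeasurableSet (Metric.ball x₀ ρ ∩ Ω) :=
    measurableSet_ball.inter hg.isOpen.measurableSet
  have hslide : ∀ x ∈ Metric.ball x₀ ρ ∩ Ω, ∀ t ∈ Ioc 0 h, x + t • vertical Φ ∈ Ω := by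
    rintro x ⟨hxρ, hxΩ⟩ t ht
    rw [Metric.mem_ball] at hxρ
    have hxr : x ∈ Metric.ball x₀ r := Metric.mem_ball.2 (by linarith)
    exact hg.add_smul_vertical_mem ht.1 ((hg.mem_iff x hxr).1 hxΩ).le (by linarith [ht.2])
  refine IsPoincareCoupling.prod_of_translate hh0.le ENNReal.ofReal_ne_top ENNReal.one_ne_top
    (map_restrict_prod_add_smul_le hA hg.isOpen.measurableSet hslide) ?_ hκ
  refine map_le_smul_restrict (by fun_prop) measurableSet_ball Measure.restrict_le_self
    (ae_restrict_of_forall_mem hA fun x hx => ?_) ?_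
  · simpa using hx.1
  · rw [one_smul, map_add_right_eq_self]

end IsLocalGraph

lemma euclideanHausdorffMeasure_image_le {X Y : Type*} [EMetricSpace X] [MeasurableSpace X]
    [BorelSpace X] [EMetricSpace Y] [MeasurableSpace Y] [BorelSpace Y] {f : X → Y} {K : ℝ≥0}
    (hf : LipschitzWith K f) (d : ℕ) (s : Set X) :
    μHE[d] (f '' s) ≤ (K : ℝ≥0∞) ^ d * μHE[d] s := by
  simp only [Measure.euclideanHausdorffMeasure_def, Measure.smul_apply, ENNReal.smul_def,
    smul_eq_mul]
  rw [mul_left_comm]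
  gcongr
  simpa using hf.hausdorffMeasure_image_le (d := (d : ℝ)) (by positivity) s

namespace IsLocalGraph

variable {n : ℕ} {Ω : Set (E n)} {x₀ : E n} {Φ : E n ≃ₗᵢ[ℝ] WithLp 2 (E (n - 1) × ℝ)}
  {γ : E (n - 1) → ℝ} {K : ℝ≥0} {r ρ h : ℝ}

lemma euclideanHausdorffMeasure_le (hg : IsLocalGraph Ω x₀ Φ γ K r) {A : Set (E n)}
    (hA : A ⊆ Metric.ball x₀ r ∩ frontier Ω) :
    (μHE[n - 1] : Measure (E n)) A ≤
      ((1 + K : ℝ≥0) : ℝ≥0∞) ^ (n - 1) * volume (graphMap Φ γ ⁻¹' A) := by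
  have himage : A ⊆ graphMap Φ γ '' (graphMap Φ γ ⁻¹' A) := by
    intro x hx
    have hfst := graphMap_fst Φ (hg.snd_eq_of_mem_frontier (hA hx).2 (hA hx).1)
    exact ⟨(Φ x).fst, by rwa [mem_preimage, hfst], hfst⟩
  rw [← EuclideanSpace.euclideanHausdorffMeasure_eq_volume]
  exact (measure_mono himage).trans
    (euclideanHausdorffMeasure_image_le (lipschitzWith_graphMap Φ hg.lipschitz) _ _)

lemma surfaceMeasure_restrict_le (hg : IsLocalGraph Ω x₀ Φ γ K r) :
    (surfaceMeasure Ω).restrict (Metric.ball x₀ r) ≤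
      ((1 + K : ℝ≥0) : ℝ≥0∞) ^ (n - 1) • (volume : Measure (E (n - 1))).map (graphMap Φ γ) := by
  have hm : Measurable (graphMap Φ γ) :=
    (lipschitzWith_graphMap Φ hg.lipschitz).continuous.measurable
  refine Measure.le_iff.2 fun A hA => ?_
  rw [surfaceMeasure, Measure.restrict_restrict measurableSet_ball, Measure.restrict_apply hA,
    Measure.smul_apply, Measure.map_apply hm hA, smul_eq_mul]
  refine (hg.euclideanHausdorffMeasure_le inter_subset_right).trans ?_
  gcongr
  exact inter_subset_left

lemma surfaceMeasure_ball_lt_top (hg : IsLocalGraph Ω x₀ Φ γ K r) :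
    surfaceMeasure Ω (Metric.ball x₀ r) < ⊤ := by
  rw [surfaceMeasure, Measure.restrict_apply measurableSet_ball]
  have hsub : graphMap Φ γ ⁻¹' (Metric.ball x₀ r ∩ frontier Ω) ⊆ Metric.ball (Φ x₀).fst r :=
    fun y hy => by simpa using (dist_fst_le Φ (graphMap Φ γ y) x₀).trans_lt hy.1
  exact (hg.euclideanHausdorffMeasure_le le_rfl).trans_lt
    (ENNReal.mul_lt_top (by finiteness) ((measure_mono hsub).trans_lt measure_ball_lt_top))

lemma surfaceMeasure_ball_pos (hg : IsLocalGraph Ω x₀ Φ γ K r) (hρ : 0 < ρ) (hr : ρ ≤ r) :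
    0 < surfaceMeasure Ω (Metric.ball x₀ ρ) := by
  rw [surfaceMeasure, Measure.restrict_apply measurableSet_ball]
  have hx₀ := hg.snd_eq_of_mem_frontier hg.mem_frontier (Metric.mem_ball_self (by linarith))
  have hproj : LipschitzWith 1 fun x => (Φ x).fst :=
    LipschitzWith.of_dist_le_mul fun x y => by simpa using dist_fst_le Φ x y
  have hsub : Metric.ball (Φ x₀).fst (ρ / (1 + K)) ⊆
      (fun x => (Φ x).fst) '' (Metric.ball x₀ ρ ∩ frontier Ω) := by
    intro y hy
    have hmem : graphMap Φ γ y ∈ Metric.ball x₀ ρ := by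
      have hdist := (lipschitzWith_graphMap Φ hg.lipschitz).dist_le_mul y (Φ x₀).fst
      rw [graphMap_fst Φ hx₀] at hdist
      rw [Metric.mem_ball, lt_div_iff₀' (by positivity)] at hy
      exact hdist.trans_lt (by exact_mod_cast hy)
    exact ⟨graphMap Φ γ y, ⟨hmem, hg.mem_frontier_of_snd_eq (by simp)
      (Metric.ball_subset_ball hr hmem)⟩, by simp⟩
  calc 0 < volume (Metric.ball (Φ x₀).fst (ρ / (1 + K))) :=
        Metric.measure_ball_pos volume _ (by positivity)
    _ ≤ μHE[n - 1] ((fun x => (Φ x).fst) '' (Metric.ball x₀ ρ ∩ frontier Ω)) := by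
        rw [EuclideanSpace.euclideanHausdorffMeasure_eq_volume]
        exact measure_mono hsub
    _ ≤ μHE[n - 1] (Metric.ball x₀ ρ ∩ frontier Ω) := by
        simpa using euclideanHausdorffMeasure_image_le hproj (n - 1) _

lemma map_surfaceMeasure_prod_add_smul_vertical_le (hg : IsLocalGraph Ω x₀ Φ γ K r)
    [SFinite (surfaceMeasure Ω)] (hh : 0 ≤ h) (hr : ρ + h ≤ r) :
    (((surfaceMeasure Ω).restrict (Metric.ball x₀ ρ)).prod (volume.restrict (Ioc 0 h))).map
      (fun a => a.1 + a.2 • vertical Φ) ≤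
        ((1 + K : ℝ≥0) : ℝ≥0∞) ^ (n - 1) • volume.restrict Ω := by
  have hslide : ∀ᵐ x ∂(surfaceMeasure Ω).restrict (Metric.ball x₀ ρ),
      ∀ t ∈ Ioc 0 h, x + t • vertical Φ ∈ Ω := by
    rw [surfaceMeasure, Measure.restrict_restrict measurableSet_ball]
    refine ae_restrict_of_forall_mem (measurableSet_ball.inter isClosed_frontier.measurableSet) ?_
    rintro x ⟨hxρ, hx⟩ t ht
    have hxr : x ∈ Metric.ball x₀ r := Metric.ball_subset_ball (by linarith) hxρ
    rw [Metric.mem_ball] at hxρ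
    exact hg.add_smul_vertical_mem ht.1 (hg.snd_eq_of_mem_frontier hx hxr).ge
      (by linarith [ht.2])
  refine map_prod_add_smul_le hg.isOpen.measurableSet
    ((Measure.restrict_mono (Metric.ball_subset_ball (by linarith)) le_rfl).trans
      hg.surfaceMeasure_restrict_le) hslide ?_
  rw [Measure.prod_smul_left, Measure.map_smul,
    ← map_graphMap_prod_add_smul_vertical Φ hg.lipschitz.continuous]
  gcongr
  · fun_prop
  · exact Measure.restrict_le_self

end IsLocalGraph

namespace IsBoundedLipschitzDomain

variable {n : ℕ} {Ω : Set (E n)}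

lemma exists_isLocalGraph (hΩ : IsBoundedLipschitzDomain Ω) {x₀ : E n} (hx₀ : x₀ ∈ frontier Ω) :
    ∃ Φ γ K r, 0 < r ∧ IsLocalGraph (Y := E (n - 1)) Ω x₀ Φ γ K r := by
  obtain ⟨Φ, γ, K, r, hγ, hr, hmem⟩ := hΩ.locally_graph x₀ hx₀
  exact ⟨Φ, γ, K, r, hr, hΩ.isOpen, hx₀, hγ, hmem⟩

lemma isFiniteMeasure_restrict_volume (hΩ : IsBoundedLipschitzDomain Ω) :
    IsFiniteMeasure ((volume : Measure (E n)).restrict Ω) :=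
  isFiniteMeasure_restrict.2 hΩ.isBounded.measure_lt_top.ne

lemma isCompact_frontier (hΩ : IsBoundedLipschitzDomain Ω) : IsCompact (frontier Ω) :=
  hΩ.isBounded.isCompact_closure.of_isClosed_subset isClosed_frontier frontier_subset_closure

lemma isFiniteMeasure_surfaceMeasure (hΩ : IsBoundedLipschitzDomain Ω) :
    IsFiniteMeasure (surfaceMeasure Ω) := by
  have hfin : surfaceMeasure Ω (frontier Ω) < ⊤ := by
    refine hΩ.isCompact_frontier.measure_lt_top_of_nhdsWithin fun x hx => ?_
    obtain ⟨Φ, γ, K, r, hr, hg⟩ := hΩ.exists_isLocalGraph hx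
    exact ⟨_, mem_nhdsWithin_of_mem_nhds (Metric.ball_mem_nhds x hr),
      hg.surfaceMeasure_ball_lt_top⟩
  rw [surfaceMeasure, Measure.restrict_apply_self] at hfin
  exact isFiniteMeasure_restrict.2 hfin.ne

lemma surfaceMeasure_restrict_ne_zero (hΩ : IsBoundedLipschitzDomain Ω) {Γ : Set (E n)}
    (hΓ : IsOpenInBoundary Ω Γ) (hne : Γ.Nonempty) : (surfaceMeasure Ω).restrict Γ ≠ 0 := by
  obtain ⟨O, hO, rfl⟩ := hΓ
  obtain ⟨x, hxO, hx⟩ := hne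
  obtain ⟨Φ, γ, K, r, hr, hg⟩ := hΩ.exists_isLocalGraph hx
  obtain ⟨δ, hδ, hδO⟩ := Metric.isOpen_iff.1 hO x hxO
  have hpos := hg.surfaceMeasure_ball_pos (lt_min hδ hr) (min_le_right δ r)
  have hsub : Metric.ball x (min δ r) ⊆ O :=
    (Metric.ball_subset_ball (min_le_left _ _)).trans hδO
  rw [Ne, Measure.restrict_eq_zero, surfaceMeasure, Measure.restrict_apply
    (hO.measurableSet.inter isClosed_frontier.measurableSet), inter_assoc, inter_self]
  rw [surfaceMeasure, Measure.restrict_apply measurableSet_ball] at hpos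
  exact (hpos.trans_le (measure_mono (inter_subset_inter_left _ hsub))).ne'

lemma isPoincareCoupling_volume_ball (hΩ : IsBoundedLipschitzDomain Ω) {z : E n} {s : ℝ}
    (hs : 0 < s) (hz : Metric.ball z s ⊆ Ω) :
    IsPoincareCoupling Ω ((volume.restrict Ω).prod (volume.restrict (Metric.ball z s))) := by
  have hball {x : E n} {ρ : ℝ} (hρ : 0 < ρ) (hx : Metric.ball x ρ ⊆ Ω) :
      IsPoincareCoupling Ω
        ((volume.restrict (Metric.ball x ρ)).prod (volume.restrict (Metric.ball z s))) :=
    isPoincareCoupling_ball hΩ.isOpen hΩ.isConnected.isPreconnected hρ hs hx hz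
  have hlocal {x : E n} (hx : x ∈ closure Ω) : ∃ ρ > 0, IsPoincareCoupling Ω
      ((volume.restrict (Metric.ball x ρ ∩ Ω)).prod (volume.restrict (Metric.ball z s))) := by
    by_cases hxΩ : x ∈ Ω
    · obtain ⟨ρ, hρ, hρΩ⟩ := Metric.isOpen_iff.1 hΩ.isOpen x hxΩ
      exact ⟨ρ, hρ, (hball hρ hρΩ).mono_restrict inter_subset_left⟩
    · obtain ⟨Φ, γ, K, r, hr, hg⟩ :=
        hΩ.exists_isLocalGraph (hΩ.isOpen.frontier_eq ▸ mem_sdiff_of_mem hx hxΩ)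
      have hρ : 0 < r / (2 * (2 + K)) := by positivity
      have hh : (1 + K) * (r / (2 * (2 + K))) < r / 2 := by
        field_simp
        linarith
      have hhr : r / 2 + r / (2 * (2 + K)) ≤ r := by
        field_simp
        linarith [K.2]
      exact ⟨_, hρ, hg.isPoincareCoupling_ball_inter hρ hh hhr
        (hball hρ (hg.ball_add_smul_vertical_subset hρ hh hhr))⟩
  have := hΩ.isFiniteMeasure_restrict_volume
  have hcompact := IsPoincareCoupling.restrict_of_isCompact (Ω := Ω) (μ := volume.restrict Ω)
    (κ := volume.restrict (Metric.ball z s)) hΩ.isBounded.isCompact_closure fun x hx => by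
      obtain ⟨ρ, hρ, h⟩ := hlocal hx
      refine ⟨_, mem_nhdsWithin_of_mem_nhds (Metric.ball_mem_nhds x hρ), ?_⟩
      rwa [Measure.restrict_restrict measurableSet_ball]
  rwa [Measure.restrict_restrict isClosed_closure.measurableSet,
    inter_eq_right.2 subset_closure] at hcompact

lemma isPoincareCoupling_surfaceMeasure_ball (hΩ : IsBoundedLipschitzDomain Ω) {z : E n} {s : ℝ}
    (hs : 0 < s) (hz : Metric.ball z s ⊆ Ω) :
    IsPoincareCoupling Ω ((surfaceMeasure Ω).prod (volume.restrict (Metric.ball z s))) := by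
  have := hΩ.isFiniteMeasure_restrict_volume
  have := hΩ.isFiniteMeasure_surfaceMeasure
  have hcompact := IsPoincareCoupling.restrict_of_isCompact (Ω := Ω) (μ := surfaceMeasure Ω)
    (κ := volume.restrict (Metric.ball z s)) hΩ.isCompact_frontier fun x hx => by
      obtain ⟨Φ, γ, K, r, hr, hg⟩ := hΩ.exists_isLocalGraph hx
      exact ⟨_, mem_nhdsWithin_of_mem_nhds (Metric.ball_mem_nhds x (half_pos hr)),
        IsPoincareCoupling.prod_of_slide (half_pos hr) (by finiteness)
          (hg.map_surfaceMeasure_prod_add_smul_vertical_le (half_pos hr).le (add_halves r).le)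
          (hΩ.isPoincareCoupling_volume_ball hs hz)⟩
  rwa [surfaceMeasure, Measure.restrict_restrict isClosed_frontier.measurableSet,
    inter_self] at hcompact

lemma isPoincareCoupling_volume_surfaceMeasure (hΩ : IsBoundedLipschitzDomain Ω) :
    IsPoincareCoupling Ω ((volume.restrict Ω).prod (surfaceMeasure Ω)) := by
  have := hΩ.isFiniteMeasure_restrict_volume
  have := hΩ.isFiniteMeasure_surfaceMeasure
  obtain ⟨z, hz⟩ := hΩ.isConnected.nonempty
  obtain ⟨s, hs, hzs⟩ := Metric.isOpen_iff.1 hΩ.isOpen z hz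
  exact (hΩ.isPoincareCoupling_volume_ball hs hzs).trans
    (hΩ.isPoincareCoupling_surfaceMeasure_ball hs hzs).symm (restrict_ball_ne_zero _ z hs)

end IsBoundedLipschitzDomain

/-! ### The trace operator -/

section Sobolev

lemma enorm_sq_eq_lintegral {α F : Type*} [MeasurableSpace α] [NormedAddCommGroup F]
    {μ : Measure α} {f : Lp F 2 μ} {φ : α → F} (h : f =ᵐ[μ] φ) :
    ‖f‖ₑ ^ 2 = ∫⁻ x, ‖φ x‖ₑ ^ 2 ∂μ := by
  rw [Lp.enorm_def, eLpNorm_congr_ae h]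
  simpa using eLpNorm_nnreal_pow_eq_lintegral (f := φ) (μ := μ) (p := 2) two_ne_zero

lemma tendsto_toLp_iff {α F ι : Type*} [MeasurableSpace α] [NormedAddCommGroup F] {μ : Measure α}
    {p : ℝ≥0∞} [Fact (1 ≤ p)] {l : Filter ι} {f : ι → α → F} (hf : ∀ i, MemLp (f i) p μ)
    {g : Lp F p μ} :
    Tendsto (fun i => (hf i).toLp (f i)) l (𝓝 g) ↔
      Tendsto (fun i => eLpNorm (fun x => f i x - g x) p μ) l (𝓝 0) := by
  rw [Lp.tendsto_Lp_iff_tendsto_eLpNorm']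
  exact tendsto_congr fun i => eLpNorm_congr_ae ((hf i).coeFn_toLp.sub EventuallyEq.rfl)

lemma tendsto_withLp_prod_iff {X Y ι : Type*} [TopologicalSpace X] [TopologicalSpace Y]
    {p : ℝ≥0∞} {l : Filter ι} {f : ι → WithLp p (X × Y)} {a : WithLp p (X × Y)} :
    Tendsto f l (𝓝 a) ↔
      Tendsto (fun i => (f i).fst) l (𝓝 a.fst) ∧ Tendsto (fun i => (f i).snd) l (𝓝 a.snd) := by
  rw [(WithLp.homeomorphProd p X Y).isInducing.tendsto_nhds_iff, nhds_prod_eq, tendsto_prod_iff']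
  rfl

variable {n : ℕ}

lemma continuous_gradient {φ : E n → ℝ} (hφ : ContDiff ℝ 1 φ) : Continuous (gradient φ) :=
  (InnerProductSpace.toDual ℝ (E n)).symm.continuous.comp (hφ.continuous_fderiv one_ne_zero)

lemma hasCompactSupport_gradient {φ : E n → ℝ} (hφ : HasCompactSupport φ) :
    HasCompactSupport (gradient φ) :=
  (hφ.fderiv ℝ).comp_left (g := (InnerProductSpace.toDual ℝ (E n)).symm) (map_zero _)

lemma enorm_gradient (φ : E n → ℝ) (x : E n) : ‖gradient φ x‖ₑ = ‖fderiv ℝ φ x‖ₑ :=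
  (InnerProductSpace.toDual ℝ (E n)).symm.enorm_map _

lemma gradient_add {φ ψ : E n → ℝ} (hφ : Differentiable ℝ φ) (hψ : Differentiable ℝ ψ) (x : E n) :
    gradient (φ + ψ) x = gradient φ x + gradient ψ x := by
  simp only [gradient, fderiv_add (hφ x) (hψ x), map_add]

lemma gradient_const_smul {φ : E n → ℝ} (hφ : Differentiable ℝ φ) (c : ℝ) (x : E n) :
    gradient (c • φ) x = c • gradient φ x := by
  simp [gradient, fderiv_const_smul (hφ x)]

/-- The space of compactly supported smooth functions on `ℝⁿ`, from which traces are extended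
by continuity. -/
def testFunctions (n : ℕ) : Submodule ℝ (E n → ℝ) where
  carrier := {φ | ContDiff ℝ ∞ φ ∧ HasCompactSupport φ}
  zero_mem' := ⟨contDiff_const, HasCompactSupport.zero⟩
  add_mem' hφ hψ := ⟨hφ.1.add hψ.1, hφ.2.add hψ.2⟩
  smul_mem' c _ hφ := ⟨hφ.1.const_smul c, hφ.2.smul_left (f := fun _ => c)⟩

lemma memLp_testFunctions {μ : Measure (E n)} [IsFiniteMeasureOnCompacts μ]
    (φ : testFunctions n) : MemLp (φ : E n → ℝ) 2 μ :=
  φ.2.1.continuous.memLp_of_hasCompactSupport φ.2.2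

lemma memLp_gradient {μ : Measure (E n)} [IsFiniteMeasureOnCompacts μ]
    (φ : testFunctions n) : MemLp (gradient (φ : E n → ℝ)) 2 μ :=
  (continuous_gradient (φ.2.1.of_le (by simp))).memLp_of_hasCompactSupport
    (hasCompactSupport_gradient φ.2.2)

/-- The space of the pairs `(u, G) ∈ L²(Ω) × L²(Ω)ⁿ`, of which `H¹(Ω)` is a subspace. -/
abbrev L2Pair (Ω : Set (E n)) : Type :=
  WithLp 2 (Lp ℝ 2 (volume.restrict Ω) × Lp (E n) 2 (volume.restrict Ω))

variable {Ω : Set (E n)}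

section TraceGraph

variable [IsFiniteMeasureOnCompacts (surfaceMeasure Ω)]

/-- The map `φ ↦ ((φ, ∇φ), φ|_S)` on test functions; the closure of its range is the graph of the
trace operator. -/
def smoothTrace (Ω : Set (E n)) [IsFiniteMeasureOnCompacts (surfaceMeasure Ω)] :
    testFunctions n →ₗ[ℝ] L2Pair Ω × Lp ℝ 2 (surfaceMeasure Ω) where
  toFun φ := (.toLp 2 ((memLp_testFunctions φ).toLp φ, (memLp_gradient φ).toLp _),
    (memLp_testFunctions φ).toLp φ)
  map_add' φ ψ := by
    have hgrad := (memLp_gradient (μ := volume.restrict Ω) (φ + ψ)).toLp_congr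
      ((memLp_gradient φ).add (memLp_gradient ψ)) (.of_forall (gradient_add
        (φ.2.1.differentiable (by simp)) (ψ.2.1.differentiable (by simp))))
    exact Prod.ext (WithLp.ofLp_injective 2 (Prod.ext rfl hgrad)) rfl
  map_smul' c φ := by
    have hgrad := (memLp_gradient (μ := volume.restrict Ω) (c • φ)).toLp_congr
      ((memLp_gradient φ).const_smul c)
      (.of_forall (gradient_const_smul (φ.2.1.differentiable (by simp)) c))
    exact Prod.ext (WithLp.ofLp_injective 2 (Prod.ext rfl hgrad)) rfl

lemma hasTrace_iff_mem_closure {v : H1 Ω} {g : Lp ℝ 2 (surfaceMeasure Ω)} :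
    HasTrace v g ↔ ((v : L2Pair Ω), g) ∈ (smoothTrace Ω).range.topologicalClosure := by
  have htendsto (φ : ℕ → testFunctions n) :
      Tendsto (fun m => smoothTrace Ω (φ m)) atTop (𝓝 ((v : L2Pair Ω), g)) ↔
        Tendsto (fun m => eLpNorm (fun x => (φ m : E n → ℝ) x - func v x) 2 (volume.restrict Ω))
          atTop (𝓝 0) ∧
        Tendsto (fun m => eLpNorm (fun x => gradient (φ m : E n → ℝ) x - grad v x) 2
          (volume.restrict Ω)) atTop (𝓝 0) ∧
        Tendsto (fun m => eLpNorm (fun x => (φ m : E n → ℝ) x - g x) 2 (surfaceMeasure Ω))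
          atTop (𝓝 0) := by
    rw [nhds_prod_eq, tendsto_prod_iff', tendsto_withLp_prod_iff, and_assoc]
    exact and_congr (tendsto_toLp_iff fun m => memLp_testFunctions (φ m))
      (and_congr (tendsto_toLp_iff fun m => memLp_gradient (φ m))
        (tendsto_toLp_iff fun m => memLp_testFunctions (φ m)))
  rw [← SetLike.mem_coe, Submodule.topologicalClosure_coe, mem_closure_iff_seq_limit]
  constructor
  · rintro ⟨φ, hφ, hlim⟩
    exact ⟨_, fun m => ⟨⟨φ m, hφ m⟩, rfl⟩, (htendsto _).2 hlim⟩
  · rintro ⟨p, hp, hlim⟩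
    choose φ hφ using hp
    obtain rfl : (fun m => smoothTrace Ω (φ m)) = p := funext hφ
    exact ⟨fun m => φ m, fun m => (φ m).2, (htendsto φ).1 hlim⟩

/-- The graph of the trace operator of `H¹(Ω)`. -/
def traceGraph (Ω : Set (E n)) [IsFiniteMeasureOnCompacts (surfaceMeasure Ω)] :
    Submodule ℝ (H1 Ω × Lp ℝ 2 (surfaceMeasure Ω)) :=
  (smoothTrace Ω).range.topologicalClosure.comap ((H1 Ω).subtype.prodMap .id)

lemma mem_traceGraph {v : H1 Ω} {g : Lp ℝ 2 (surfaceMeasure Ω)} :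
    (v, g) ∈ traceGraph Ω ↔ HasTrace v g :=
  hasTrace_iff_mem_closure.symm

lemma isClosed_traceGraph : IsClosed (traceGraph Ω : Set (H1 Ω × Lp ℝ 2 (surfaceMeasure Ω))) :=
  (smoothTrace Ω).range.isClosed_topologicalClosure.preimage
    (continuous_subtype_val.prodMap continuous_id)

lemma le_of_mem_traceGraph {f g : L2Pair Ω × Lp ℝ 2 (surfaceMeasure Ω) → ℝ} (hf : Continuous f)
    (hg : Continuous g) (hfg : ∀ φ, f (smoothTrace Ω φ) ≤ g (smoothTrace Ω φ))
    {v : H1 Ω} {w : Lp ℝ 2 (surfaceMeasure Ω)} (hv : HasTrace v w) : f (v, w) ≤ g (v, w) :=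
  le_on_closure (forall_mem_range.2 hfg) hf.continuousOn hg.continuousOn
    (hasTrace_iff_mem_closure.1 hv)

end TraceGraph

lemma isClosed_map_fst {X Y : Type*} [NormedAddCommGroup X] [NormedSpace ℝ X] [CompleteSpace X]
    [NormedAddCommGroup Y] [NormedSpace ℝ Y] [CompleteSpace Y] {G : Submodule ℝ (X × Y)}
    (hG : IsClosed (G : Set (X × Y))) {C : ℝ≥0} (hC : ∀ p ∈ G, ‖p.2‖ ≤ C * ‖p.1‖) :
    IsClosed (G.map (LinearMap.fst ℝ X Y) : Set X) := by
  have := hG.completeSpace_coe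
  let f : G →L[ℝ] X := (ContinuousLinearMap.fst ℝ X Y).comp G.subtypeL
  have hf : AntilipschitzWith (max 1 C) f := by
    refine AddMonoidHomClass.antilipschitz_of_bound f fun p => max_le ?_ ?_
    · exact le_mul_of_one_le_left (norm_nonneg _) (mod_cast le_max_left _ _)
    · refine (hC p p.2).trans (mul_le_mul_of_nonneg_right ?_ (norm_nonneg _))
      exact_mod_cast le_max_right 1 C
  have hrange : (G.map (LinearMap.fst ℝ X Y) : Set X) = range f := by
    ext x
    simp [f]
  exact hrange ▸ hf.isClosed_range f.uniformContinuous

lemma existsUnique_forall_mem_eq {H : Type*} [NormedAddCommGroup H] [InnerProductSpace ℝ H]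
    {V : Submodule ℝ H} [CompleteSpace V] (B : H →L[ℝ] H →L[ℝ] ℝ)
    (hB : ∃ c > 0, ∀ v ∈ V, c * ‖v‖ ^ 2 ≤ B v v) (ℓ : H →L[ℝ] ℝ) :
    ∃! u, u ∈ V ∧ ∀ w ∈ V, B u w = ℓ w := by
  obtain ⟨c, hc, hcoer⟩ := hB
  let b : V →L[ℝ] V →L[ℝ] ℝ := B.bilinearComp V.subtypeL V.subtypeL
  have hb : IsCoercive b := ⟨c, hc, fun v => by
    rw [mul_assoc, ← pow_two]
    exact hcoer v v.2⟩
  let u : V := hb.continuousLinearEquivOfBilin.symm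
    ((InnerProductSpace.toDual ℝ V).symm (ℓ.comp V.subtypeL))
  have hu (w : V) : b u w = ℓ w := by
    rw [← hb.continuousLinearEquivOfBilin_apply, ContinuousLinearEquiv.apply_symm_apply,
      InnerProductSpace.toDual_symm_apply]
    rfl
  refine ⟨u, ⟨u.2, fun w hw => hu ⟨w, hw⟩⟩, fun v ⟨hv, hvℓ⟩ => ?_⟩
  have hsub : B (v - u) (v - u) = 0 := by
    have hvu := sub_mem hv u.2
    rw [map_sub B, _root_.sub_apply, hvℓ _ hvu, sub_eq_zero]
    exact (hu ⟨v - u, hvu⟩).symm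
  have hnorm : ‖v - u‖ ^ 2 ≤ 0 := by
    have := hcoer _ (sub_mem hv u.2)
    rw [hsub] at this
    exact nonpos_of_mul_nonpos_right this hc
  exact sub_eq_zero.1 (norm_eq_zero.1 (pow_eq_zero_iff two_ne_zero |>.1
    (hnorm.antisymm (sq_nonneg _))))

/-- The restriction of functions on the boundary to a part `Γ` of it. -/
abbrev restrictTo (Γ : Set (E n)) :
    Lp ℝ 2 (surfaceMeasure Ω) →L[ℝ] Lp ℝ 2 ((surfaceMeasure Ω).restrict Γ) :=
  LpToLpRestrictCLM (E n) ℝ ℝ (surfaceMeasure Ω) 2 Γ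

lemma restrictTo_eq_iff {Γ : Set (E n)} {g : Lp ℝ 2 (surfaceMeasure Ω)}
    {f : Lp ℝ 2 ((surfaceMeasure Ω).restrict Γ)} :
    restrictTo Γ g = f ↔ g =ᵐ[(surfaceMeasure Ω).restrict Γ] f := by
  have h := LpToLpRestrictCLM_coeFn ℝ (p := 2) Γ g
  exact ⟨fun e => e ▸ h.symm, fun e => Lp.ext (h.trans e)⟩

lemma restrictTo_eq_zero_iff {Γ : Set (E n)} {g : Lp ℝ 2 (surfaceMeasure Ω)} :
    restrictTo Γ g = 0 ↔ g =ᵐ[(surfaceMeasure Ω).restrict Γ] 0 := by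
  rw [restrictTo_eq_iff]
  exact ⟨fun h => h.trans (Lp.coeFn_zero _ _ _), fun h => h.trans (Lp.coeFn_zero _ _ _).symm⟩

lemma norm_sq_eq (v : H1 Ω) : ‖v‖ ^ 2 = ‖func v‖ ^ 2 + ‖grad v‖ ^ 2 :=
  WithLp.prod_norm_sq_eq_of_L2 (v : L2Pair Ω)

namespace IsBoundedLipschitzDomain

lemma setLIntegral_sq_le_surfaceMeasure (hΩ : IsBoundedLipschitzDomain Ω) {Γ : Set (E n)}
    (hΓ : (surfaceMeasure Ω).restrict Γ ≠ 0) :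
    ∃ C : ℝ≥0∞, C ≠ ⊤ ∧ ∀ φ : E n → ℝ, ContDiff ℝ 1 φ →
      ∫⁻ x in Ω, ‖φ x‖ₑ ^ 2 ≤
        C * (energy Ω φ + ∫⁻ x in Γ, ‖φ x‖ₑ ^ 2 ∂surfaceMeasure Ω) := by
  have := hΩ.isFiniteMeasure_restrict_volume
  have := hΩ.isFiniteMeasure_surfaceMeasure
  have hΓΩ := hΩ.isPoincareCoupling_volume_surfaceMeasure.symm
  rw [← Measure.restrict_univ (μ := surfaceMeasure Ω)] at hΓΩ
  exact (hΓΩ.mono_restrict (subset_univ Γ)).symm.lintegral_sq_le hΓ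

lemma lintegral_surfaceMeasure_sq_le (hΩ : IsBoundedLipschitzDomain Ω) :
    ∃ C : ℝ≥0∞, C ≠ ⊤ ∧ ∀ φ : E n → ℝ, ContDiff ℝ 1 φ →
      ∫⁻ x, ‖φ x‖ₑ ^ 2 ∂surfaceMeasure Ω ≤ C * (energy Ω φ + ∫⁻ x in Ω, ‖φ x‖ₑ ^ 2) := by
  have := hΩ.isFiniteMeasure_restrict_volume
  have := hΩ.isFiniteMeasure_surfaceMeasure
  refine hΩ.isPoincareCoupling_volume_surfaceMeasure.symm.lintegral_sq_le ?_
  rw [Ne, Measure.restrict_eq_zero]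
  exact (hΩ.isOpen.measure_pos volume hΩ.isConnected.nonempty).ne'

lemma exists_norm_trace_le (hΩ : IsBoundedLipschitzDomain Ω) :
    ∃ C : ℝ≥0, ∀ (v : H1 Ω) (g : Lp ℝ 2 (surfaceMeasure Ω)), HasTrace v g →
      ‖g‖ ≤ C * ‖v‖ := by
  have := hΩ.isFiniteMeasure_surfaceMeasure
  obtain ⟨C, hCtop, hC⟩ := hΩ.lintegral_surfaceMeasure_sq_le
  lift C to ℝ≥0 using hCtop
  refine ⟨NNReal.sqrt C, fun v g hg => le_of_mem_traceGraph (f := fun p => ‖p.2‖)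
    (g := fun p => NNReal.sqrt C * ‖p.1‖) (by fun_prop) (by fun_prop) (fun φ => ?_) hg⟩
  have h := hC φ (φ.2.1.of_le (by simp))
  simp only [energy, ← enorm_gradient] at h
  rw [← enorm_sq_eq_lintegral (memLp_testFunctions φ).coeFn_toLp,
    ← enorm_sq_eq_lintegral (memLp_testFunctions φ).coeFn_toLp,
    ← enorm_sq_eq_lintegral (memLp_gradient φ).coeFn_toLp, add_comm] at h
  rw [← pow_le_pow_iff_left₀ (norm_nonneg _) (by positivity) two_ne_zero, mul_pow,
    WithLp.prod_norm_sq_eq_of_L2, ← NNReal.coe_pow, NNReal.sq_sqrt]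
  simp only [enorm_eq_nnnorm] at h
  exact_mod_cast h

lemma exists_norm_func_sq_le (hΩ : IsBoundedLipschitzDomain Ω) {Γ : Set (E n)}
    (hΓ : (surfaceMeasure Ω).restrict Γ ≠ 0) :
    ∃ C : ℝ≥0, ∀ (v : H1 Ω) (g : Lp ℝ 2 (surfaceMeasure Ω)), HasTrace v g →
      ‖func v‖ ^ 2 ≤ C * (‖grad v‖ ^ 2 + ‖restrictTo Γ g‖ ^ 2) := by
  have := hΩ.isFiniteMeasure_surfaceMeasure
  obtain ⟨C, hCtop, hC⟩ := hΩ.setLIntegral_sq_le_surfaceMeasure hΓ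
  lift C to ℝ≥0 using hCtop
  have hfst : Continuous fun p : L2Pair Ω × Lp ℝ 2 (surfaceMeasure Ω) => p.1.fst :=
    (WithLp.fstL 2 ℝ _ _).continuous.comp continuous_fst
  have hsnd : Continuous fun p : L2Pair Ω × Lp ℝ 2 (surfaceMeasure Ω) => p.1.snd :=
    (WithLp.sndL 2 ℝ _ _).continuous.comp continuous_fst
  refine ⟨C, fun v g hg => le_of_mem_traceGraph (f := fun p => ‖p.1.fst‖ ^ 2)
    (g := fun p => C * (‖p.1.snd‖ ^ 2 + ‖restrictTo Γ p.2‖ ^ 2)) (hfst.norm.pow 2)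
    (continuous_const.mul ((hsnd.norm.pow 2).add (by fun_prop))) (fun φ => ?_) hg⟩
  have h := hC φ (φ.2.1.of_le (by simp))
  simp only [energy, ← enorm_gradient] at h
  rw [← enorm_sq_eq_lintegral (memLp_testFunctions φ).coeFn_toLp,
    ← enorm_sq_eq_lintegral (memLp_gradient φ).coeFn_toLp,
    ← enorm_sq_eq_lintegral ((LpToLpRestrictCLM_coeFn ℝ (p := 2) Γ _).trans
      (ae_restrict_of_ae (memLp_testFunctions φ).coeFn_toLp))] at h
  simp only [enorm_eq_nnnorm] at h
  exact_mod_cast h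

end IsBoundedLipschitzDomain

/-- The space of the functions of `H¹(Ω)` whose trace vanishes on `Γ`. -/
def traceVanishing (Ω Γ : Set (E n)) [IsFiniteMeasureOnCompacts (surfaceMeasure Ω)] :
    Submodule ℝ (H1 Ω) :=
  (traceGraph Ω ⊓ ((restrictTo Γ).comp (.snd ℝ _ _)).ker).map (.fst ℝ _ _)

lemma mem_traceVanishing {Γ : Set (E n)} [IsFiniteMeasureOnCompacts (surfaceMeasure Ω)]
    {v : H1 Ω} :
    v ∈ traceVanishing Ω Γ ↔ ∃ g : Lp ℝ 2 (surfaceMeasure Ω), HasTrace v g ∧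
      g =ᵐ[(surfaceMeasure Ω).restrict Γ] 0 := by
  simp [traceVanishing, mem_traceGraph, restrictTo_eq_zero_iff]

/-! ### The mixed problem -/

lemma isClosed_H1 (Ω : Set (E n)) : IsClosed (H1 Ω : Set (L2Pair Ω)) := by
  have hH1 : (H1 Ω : Set (L2Pair Ω)) = {p | IsWeakGradient Ω p.fst p.snd} := rfl
  simp only [hH1, IsWeakGradient, ofPred_forall]
  refine isClosed_iInter fun φ => isClosed_iInter fun hφ => isClosed_iInter fun hφc =>
    isClosed_iInter fun _ => isClosed_iInter fun i => ?_
  have hd := test_deriv hφ hφc (EuclideanSpace.single i 1)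
  have hmd : MemLp (fun x => fderiv ℝ φ x (EuclideanSpace.single i 1)) 2 (volume.restrict Ω) :=
    hd.1.memLp_of_hasCompactSupport hd.2
  have hm : MemLp (fun x => φ x • (EuclideanSpace.single i 1 : E n)) 2 (volume.restrict Ω) :=
    (hφ.continuous.smul continuous_const).memLp_of_hasCompactSupport hφc.smul_right
  have hfst (p : L2Pair Ω) :
      ∫ x in Ω, p.fst x * fderiv ℝ φ x (EuclideanSpace.single i 1) =
        inner ℝ (hmd.toLp _) p.fst := by
    rw [L2.inner_def]
    refine integral_congr_ae ?_
    filter_upwards [hmd.coeFn_toLp] with x hx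
    rw [hx]
    rfl
  have hsnd (p : L2Pair Ω) : ∫ x in Ω, p.snd x i * φ x = inner ℝ (hm.toLp _) p.snd := by
    rw [L2.inner_def]
    refine integral_congr_ae ?_
    filter_upwards [hm.coeFn_toLp] with x hx
    rw [hx, real_inner_smul_left, EuclideanSpace.inner_single_left, mul_comm]
    simp
  simp only [hfst, hsnd]
  exact isClosed_eq (continuous_const.inner (WithLp.fstL 2 ℝ _ _).continuous)
    (continuous_const.inner (WithLp.sndL 2 ℝ _ _).continuous).neg

instance completeSpace_H1 (Ω : Set (E n)) : CompleteSpace (H1 Ω) :=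
  (isClosed_H1 Ω).completeSpace_coe

lemma isClosed_traceVanishing (hΩ : IsBoundedLipschitzDomain Ω) (Γ : Set (E n))
    [IsFiniteMeasureOnCompacts (surfaceMeasure Ω)] :
    IsClosed (traceVanishing Ω Γ : Set (H1 Ω)) := by
  obtain ⟨C, hC⟩ := hΩ.exists_norm_trace_le
  exact isClosed_map_fst (isClosed_traceGraph.inter (ContinuousLinearMap.isClosed_ker _))
    fun p hp => hC p.1 p.2 (mem_traceGraph.1 hp.1)

/-- The map `h ↦ grad h`. -/
def gradL (Ω : Set (E n)) : H1 Ω →L[ℝ] Lp (E n) 2 (volume.restrict Ω) :=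
  (WithLp.sndL 2 ℝ _ _).comp (H1 Ω).subtypeL

/-- The bilinear form `form ε` as a continuous map. -/
def formL {ε : E n → ℝ} (hε : MemLp ε ∞ (volume.restrict Ω)) : H1 Ω →L[ℝ] H1 Ω →L[ℝ] ℝ :=
  (innerSL ℝ).bilinearComp
    (((ContinuousLinearMap.lsmul ℝ ℝ).holderL (volume.restrict Ω) ∞ 2 2 (hε.toLp ε)).comp
      (gradL Ω)) (gradL Ω)

lemma formL_apply {ε : E n → ℝ} (hε : MemLp ε ∞ (volume.restrict Ω)) (v h : H1 Ω) :
    formL hε v h = form ε v h := by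
  change inner ℝ ((ContinuousLinearMap.lsmul ℝ ℝ).holder 2 (hε.toLp ε) (grad v)) (grad h) = _
  rw [L2.inner_def, form]
  refine integral_congr_ae ?_
  filter_upwards [(ContinuousLinearMap.lsmul ℝ ℝ).coeFn_holder (r := 2) (hε.toLp ε) (grad v),
    hε.coeFn_toLp] with x hx hεx
  rw [hx, hεx, ContinuousLinearMap.lsmul_apply, real_inner_smul_left]

lemma mul_norm_grad_sq_le_form {ε : E n → ℝ} (hε : MemLp ε ∞ (volume.restrict Ω)) {e : ℝ}
    (hbd : ∀ᵐ x ∂(volume.restrict Ω), e ≤ ε x) (v : H1 Ω) :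
    e * ‖grad v‖ ^ 2 ≤ form ε v v := by
  have hgrad := L2.integrable_inner (𝕜 := ℝ) (grad v) (grad v)
  rw [← real_inner_self_eq_norm_sq, L2.inner_def, ← integral_const_mul, form]
  refine integral_mono_ae (hgrad.const_mul e) (hgrad.mul_of_top_right hε) ?_
  filter_upwards [hbd] with x hx
  exact mul_le_mul_of_nonneg_right hx real_inner_self_nonneg

lemma form_sub {ε : E n → ℝ} (hε : MemLp ε ∞ (volume.restrict Ω)) (v w h : H1 Ω) :
    form ε (v - w) h = form ε v h - form ε w h := by
  simp only [← formL_apply hε, map_sub, _root_.sub_apply]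

lemma exists_mul_norm_sq_le_form (hΩ : IsBoundedLipschitzDomain Ω) {Γ : Set (E n)}
    (hΓ : (surfaceMeasure Ω).restrict Γ ≠ 0) {ε : E n → ℝ} (hε : MemLp ε ∞ (volume.restrict Ω))
    {e : ℝ} (he : 0 < e) (hbd : ∀ᵐ x ∂(volume.restrict Ω), e ≤ ε x) :
    ∃ c > 0, ∀ (v : H1 Ω) (g : Lp ℝ 2 (surfaceMeasure Ω)), HasTrace v g →
      g =ᵐ[(surfaceMeasure Ω).restrict Γ] 0 → c * ‖v‖ ^ 2 ≤ form ε v v := by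
  obtain ⟨C, hC⟩ := hΩ.exists_norm_func_sq_le hΓ
  refine ⟨e / (C + 1), by positivity, fun v g hg hg0 => ?_⟩
  have hfunc := hC v g hg
  rw [restrictTo_eq_zero_iff.2 hg0, norm_zero] at hfunc
  calc e / (C + 1) * ‖v‖ ^ 2 ≤ e / (C + 1) * ((C + 1) * ‖grad v‖ ^ 2) := by
        rw [norm_sq_eq]
        gcongr
        linarith
    _ = e * ‖grad v‖ ^ 2 := by field_simp
    _ ≤ form ε v v := mul_norm_grad_sq_le_form hε hbd v

lemma IsOpenInBoundary.iUnion_union {ι : Type*} {A B : ι → Set (E n)}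
    (hA : ∀ i, IsOpenInBoundary Ω (A i)) (hB : ∀ i, IsOpenInBoundary Ω (B i)) :
    IsOpenInBoundary Ω (⋃ i, (A i ∪ B i)) := by
  choose O hO hAO using hA
  choose P hP hBP using hB
  refine ⟨⋃ i, (O i ∪ P i), isOpen_iUnion fun i => (hO i).union (hP i), ?_⟩
  simp only [iUnion_inter, union_inter_distrib_right, hAO, hBP]

lemma IsOpenInBoundary.subset_sdiff_closure {A B : Set (E n)} (hA : IsOpenInBoundary Ω A)
    (hB : IsOpenInBoundary Ω B) (h : Disjoint A B) : A ⊆ frontier Ω \ closure B := by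
  obtain ⟨O, hO, rfl⟩ := hA
  obtain ⟨P, -, rfl⟩ := hB
  have hdisj : Disjoint O (P ∩ frontier Ω) :=
    disjoint_left.2 fun x hxO hx => disjoint_left.1 h ⟨hxO, hx.2⟩ hx
  exact fun x hx => ⟨hx.2, disjoint_left.1 (hdisj.closure_right hO) hx.1⟩

variable {k : ℕ} {Γ Γ₀ : Fin k → Set (E n)}

lemma existsUnique_solvesVariational (hΩ : IsBoundedLipschitzDomain Ω)
    (hΓ : (surfaceMeasure Ω).restrict (⋃ i, (Γ i ∪ Γ₀ i)) ≠ 0) {ε : E n → ℝ}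
    (hε : MemLp ε ∞ (volume.restrict Ω)) {e : ℝ} (he : 0 < e)
    (hbd : ∀ᵐ x ∂(volume.restrict Ω), e ≤ ε x) (θ' : H1 Ω) :
    ∃! u, SolvesVariational Γ Γ₀ ε θ' u := by
  have := hΩ.isFiniteMeasure_surfaceMeasure
  have := (isClosed_traceVanishing hΩ (⋃ i, (Γ i ∪ Γ₀ i))).completeSpace_coe
  obtain ⟨c, hc, hcoer⟩ := exists_mul_norm_sq_le_form hΩ hΓ hε he hbd
  have hV : ∀ v ∈ traceVanishing Ω (⋃ i, (Γ i ∪ Γ₀ i)), c * ‖v‖ ^ 2 ≤ formL hε v v := by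
    intro v hv
    obtain ⟨g, hg, hg0⟩ := mem_traceVanishing.1 hv
    exact (hcoer v g hg hg0).trans_eq (formL_apply hε v v).symm
  have hex := existsUnique_forall_mem_eq (formL hε) ⟨c, hc, hV⟩ (-formL hε θ')
  simp only [mem_traceVanishing, formL_apply, _root_.neg_apply] at hex
  exact hex

lemma mem_Vtilde_iff_dirichletData {v : H1 Ω} :
    v ∈ Vtilde Ω Γ Γ₀ ↔ DirichletData Γ Γ₀ 0 v := by
  have hzero (i : Fin k) {g : Lp ℝ 2 (surfaceMeasure Ω)} :
      g =ᵐ[(surfaceMeasure Ω).restrict (Γ i)] (0 : Lp ℝ 2 ((surfaceMeasure Ω).restrict (Γ i))) ↔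
        g =ᵐ[(surfaceMeasure Ω).restrict (Γ i)] 0 := by
    rw [← restrictTo_eq_iff, restrictTo_eq_zero_iff]
  simp only [Vtilde, DirichletData, mem_ofPred_eq, Pi.zero_apply, hzero, ← forall_and]
  simp only [EventuallyEq, ae_restrict_iUnion_iff, ae_restrict_union_iff]

lemma exists_dirichletData_single (hΓ : ∀ i, IsOpenInBoundary Ω (Γ i))
    (hΓ₀ : ∀ i, IsOpenInBoundary Ω (Γ₀ i)) (hdisj : ∀ i j, i ≠ j → Disjoint (Γ i) (Γ j))
    (hdisj₀ : ∀ i j, Disjoint (Γ i) (Γ₀ j)) {i : Fin k}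
    {ψ : Lp ℝ 2 ((surfaceMeasure Ω).restrict (Γ i))} (hψ : ψ ∈ H00half Ω (Γ i)) :
    ∃ v, DirichletData Γ Γ₀ (Pi.single i ψ) v := by
  obtain ⟨v, g, hg, hgψ, hg0⟩ := hψ
  have hzero {A : Set (E n)} (hA : IsOpenInBoundary Ω A) (h : Disjoint A (Γ i)) :
      g =ᵐ[(surfaceMeasure Ω).restrict A] 0 :=
    ae_restrict_of_ae_restrict_of_subset (hA.subset_sdiff_closure (hΓ i) h) hg0
  refine ⟨v, g, hg, fun j => ?_, fun j => hzero (hΓ₀ j) (hdisj₀ i j).symm⟩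
  obtain rfl | hij := eq_or_ne j i
  · rwa [Pi.single_eq_same]
  · rw [Pi.single_eq_of_ne hij]
    exact (hzero (hΓ j) (hdisj j i hij)).trans (Lp.coeFn_zero _ _ _).symm

/-- The pairs `(v, U)` of a function of `H¹(Ω)` and Dirichlet data attained by it. -/
def dirichletGraph (Γ Γ₀ : Fin k → Set (E n)) [IsFiniteMeasureOnCompacts (surfaceMeasure Ω)] :
    Submodule ℝ (H1 Ω × ∀ i, Lp ℝ 2 ((surfaceMeasure Ω).restrict (Γ i))) :=
  (traceGraph Ω ⊓ ⨅ i, ((restrictTo (Γ₀ i)).comp (.snd ℝ _ _)).ker).map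
    (LinearMap.id.prodMap (.pi fun i => (restrictTo (Γ i)).toLinearMap))

section Dirichlet

variable [IsFiniteMeasureOnCompacts (surfaceMeasure Ω)]
  {U : ∀ i, Lp ℝ 2 ((surfaceMeasure Ω).restrict (Γ i))}

lemma mem_dirichletGraph {v : H1 Ω} :
    (v, U) ∈ dirichletGraph Γ Γ₀ ↔ DirichletData Γ Γ₀ U v := by
  simp only [DirichletData, ← restrictTo_eq_iff, ← restrictTo_eq_zero_iff]
  simp only [dirichletGraph, Submodule.mem_map, Submodule.mem_inf, Submodule.mem_iInf, Prod.exists,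
    mem_traceGraph, LinearMap.prodMap_apply, Prod.mk.injEq, funext_iff]
  constructor
  · rintro ⟨_, g, ⟨hg, hg0⟩, rfl, hgU⟩
    exact ⟨g, hg, hgU, hg0⟩
  · rintro ⟨g, hg, hgU, hg0⟩
    exact ⟨v, g, ⟨hg, hg0⟩, rfl, hgU⟩

lemma DirichletData.iff_sub_mem_Vtilde {θ θ' : H1 Ω} (hθ' : DirichletData Γ Γ₀ U θ') :
    DirichletData Γ Γ₀ U θ ↔ θ - θ' ∈ Vtilde Ω Γ Γ₀ := by
  have hsub : (θ, U) - (θ', U) = (θ - θ', 0) := Prod.ext rfl (sub_self U)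
  rw [mem_Vtilde_iff_dirichletData, ← mem_dirichletGraph, ← mem_dirichletGraph, ← hsub]
  exact (Submodule.sub_mem_iff_left _ (mem_dirichletGraph.2 hθ')).symm

lemma DirichletData.isGeneralizedSolution_iff {ε : E n → ℝ} (hε : MemLp ε ∞ (volume.restrict Ω))
    {θ θ' : H1 Ω} (hθ' : DirichletData Γ Γ₀ U θ') :
    IsGeneralizedSolution Γ Γ₀ ε U θ ↔ SolvesVariational Γ Γ₀ ε θ' (θ - θ') := by
  refine and_congr hθ'.iff_sub_mem_Vtilde (forall₂_congr fun h _ => ?_)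
  rw [form_sub hε, sub_eq_neg_self]

lemma exists_dirichletData (hΓ : ∀ i, IsOpenInBoundary Ω (Γ i))
    (hΓ₀ : ∀ i, IsOpenInBoundary Ω (Γ₀ i)) (hdisj : ∀ i j, i ≠ j → Disjoint (Γ i) (Γ j))
    (hdisj₀ : ∀ i j, Disjoint (Γ i) (Γ₀ j)) (hU : ∀ i, U i ∈ H00half Ω (Γ i)) :
    ∃ v, DirichletData Γ Γ₀ U v := by
  choose v hv using fun i => exists_dirichletData_single hΓ hΓ₀ hdisj hdisj₀ (hU i)
  have hsum : ∑ i, (v i, Pi.single i (U i)) = (∑ i, v i, U) :=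
    Prod.ext Prod.fst_sum (Prod.snd_sum.trans (Finset.univ_sum_single U))
  exact ⟨_, mem_dirichletGraph.1 (hsum ▸ sum_mem fun i _ => mem_dirichletGraph.2 (hv i))⟩

end Dirichlet

lemma existsUnique_isGeneralizedSolution (hΩ : IsBoundedLipschitzDomain Ω)
    (hΓ : (surfaceMeasure Ω).restrict (⋃ i, (Γ i ∪ Γ₀ i)) ≠ 0) {ε : E n → ℝ}
    (hε : MemLp ε ∞ (volume.restrict Ω)) {e : ℝ} (he : 0 < e)
    (hbd : ∀ᵐ x ∂(volume.restrict Ω), e ≤ ε x)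
    {U : ∀ i, Lp ℝ 2 ((surfaceMeasure Ω).restrict (Γ i))} {θ' : H1 Ω}
    (hθ' : DirichletData Γ Γ₀ U θ') : ∃! θ, IsGeneralizedSolution Γ Γ₀ ε U θ := by
  have := hΩ.isFiniteMeasure_surfaceMeasure
  simp only [hθ'.isGeneralizedSolution_iff hε]
  exact (Equiv.subRight θ').existsUnique_congr_left.2
    (by simpa using existsUnique_solvesVariational hΩ hΓ hε he hbd θ')

end Sobolev

end Electrostatics

end

theorem theorem2p1_general {n : ℕ} {Ω : Set (Electrostatics.E n)}
    (hΩ : Electrostatics.IsBoundedLipschitzDomain Ω)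
    {k : ℕ} (Γ Γ₀ : Fin k → Set (Electrostatics.E n))
    (hΓ : ∀ i, Electrostatics.IsOpenInBoundary Ω (Γ i))
    (hΓ₀ : ∀ i, Electrostatics.IsOpenInBoundary Ω (Γ₀ i))
    (hne : (⋃ i, (Γ i ∪ Γ₀ i)).Nonempty)
    (hdisj : ∀ i j, i ≠ j → Disjoint (Γ i) (Γ j))
    (hdisj₀ : ∀ i j, Disjoint (Γ i) (Γ₀ j))
    (ε : Electrostatics.E n → ℝ) (hε : MemLp ε ∞ (volume.restrict Ω))
    (e : ℝ) (he : 0 < e) (hbd : ∀ᵐ x ∂(volume.restrict Ω), e ≤ ε x)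
    (U : ∀ i, Lp ℝ 2 ((Electrostatics.surfaceMeasure Ω).restrict (Γ i)))
    (hU : ∀ i, U i ∈ Electrostatics.H00half Ω (Γ i)) :
    (∃ θ' : Electrostatics.H1 Ω, Electrostatics.DirichletData Γ Γ₀ U θ') ∧
      ∃ θ : Electrostatics.H1 Ω,
        Electrostatics.IsGeneralizedSolution Γ Γ₀ ε U θ ∧
        (∀ η : Electrostatics.H1 Ω, Electrostatics.IsGeneralizedSolution Γ Γ₀ ε U η → η = θ) ∧
        ∀ θ' : Electrostatics.H1 Ω, Electrostatics.DirichletData Γ Γ₀ U θ' →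
          ∃ u : Electrostatics.H1 Ω,
            Electrostatics.SolvesVariational Γ Γ₀ ε θ' u ∧
            (∀ w : Electrostatics.H1 Ω,
              Electrostatics.SolvesVariational Γ Γ₀ ε θ' w → w = u) ∧
            θ = θ' + u := by
  have := hΩ.isFiniteMeasure_surfaceMeasure
  have hpos := hΩ.surfaceMeasure_restrict_ne_zero (.iUnion_union hΓ hΓ₀) hne
  obtain ⟨θ₀, hθ₀⟩ := Electrostatics.exists_dirichletData hΓ hΓ₀ hdisj hdisj₀ hU
  obtain ⟨θ, hθ, huniq⟩ :=
    Electrostatics.existsUnique_isGeneralizedSolution hΩ hpos hε he hbd hθ₀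
  refine ⟨⟨θ₀, hθ₀⟩, θ, hθ, huniq, fun θ' hθ' => ⟨θ - θ', ?_, fun w hw => ?_, by abel⟩⟩
  · exact (hθ'.isGeneralizedSolution_iff hε).1 hθ
  · rw [← huniq (θ' + w) ((hθ'.isGeneralizedSolution_iff hε).2 (by rwa [add_sub_cancel_left])),
      add_sub_cancel_left]

theorem theorem2p1 {n : ℕ} (hn : n = 2 ∨ n = 3)
    {Ω : Set (Electrostatics.E n)} (hΩ : Electrostatics.IsBoundedLipschitzDomain Ω)
    {k : ℕ} (Γ Γ₀ : Fin k → Set (Electrostatics.E n))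
    (hΓ : ∀ i, Electrostatics.IsOpenInBoundary Ω (Γ i))
    (hΓ₀ : ∀ i, Electrostatics.IsOpenInBoundary Ω (Γ₀ i))
    (hne : (⋃ i, (Γ i ∪ Γ₀ i)).Nonempty)
    (hdisj : ∀ i j, i ≠ j → Disjoint (Γ i) (Γ j))
    (hdisj₀ : ∀ i j, Disjoint (Γ i) (Γ₀ j))
    (ε : Electrostatics.E n → ℝ) (hε : MemLp ε ∞ (volume.restrict Ω))
    (e₁ e₂ : ℝ) (he₁ : 0 < e₁) (he₂ : 0 < e₂)
    (hbd : ∀ᵐ x ∂(volume.restrict Ω), e₁ ≤ ε x ∧ ε x ≤ e₂)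
    (T : ℝ) (hT : 0 < T)
    (U : ∀ i, ℝ → Lp ℝ 2 ((Electrostatics.surfaceMeasure Ω).restrict (Γ i)))
    (hU : ∀ t ∈ Icc (0 : ℝ) T, ∀ i, U i t ∈ Electrostatics.H00half Ω (Γ i)) :
    ∀ t ∈ Icc (0 : ℝ) T,
      (∃ θ' : Electrostatics.H1 Ω,
        Electrostatics.DirichletData Γ Γ₀ (fun i => U i t) θ') ∧
      ∃ θ : Electrostatics.H1 Ω,
        Electrostatics.IsGeneralizedSolution Γ Γ₀ ε (fun i => U i t) θ ∧
        (∀ η : Electrostatics.H1 Ω,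
          Electrostatics.IsGeneralizedSolution Γ Γ₀ ε (fun i => U i t) η → η = θ) ∧
        ∀ θ' : Electrostatics.H1 Ω,
          Electrostatics.DirichletData Γ Γ₀ (fun i => U i t) θ' →
          ∃ u : Electrostatics.H1 Ω,
            Electrostatics.SolvesVariational Γ Γ₀ ε θ' u ∧
            (∀ w : Electrostatics.H1 Ω,
              Electrostatics.SolvesVariational Γ Γ₀ ε θ' w → w = u) ∧
            θ = θ' + u :=
  fun t ht => theorem2p1_general hΩ Γ Γ₀ hΓ hΓ₀ hne hdisj hdisj₀ ε hε e₁ he₁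
    (hbd.mono fun _ h => h.1) (fun i => U i t) (hU t ht)
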